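/- **Setting.** For a natural number $u$ let $U=[u]=\{0,\dots,u-1\}$, and let $R=[2^\rho]$, viewed as the set of bit strings of length $\rho$; $\oplus$ is bit-wise exclusive-or. Let $\Phi=[2^b]$ be an alphabet of $b$-bit characters. If $u\le |\Phi|^{n}$, a key $x\in U$ is viewed as the vector $(x_0,\dots,x_{n-1})\in\Phi^{n}$ of its $n$ base-$2^b$ digits. A *simple tabulation* function with character tables $t_0,\dots,t_{n-1}$ maps $(x_0,\dots,x_{n-1})$ to $t_0(x_0)\oplus\dots\oplus t_{n-1}(x_{n-1})$. *Double tabulation* is the composition $r\circ h:U\to R$ of two simple tabulation functions, $h:\Phi^{n}\to\Phi^{d}$ (with tables $\Phi\to\Phi^d$) and $r:\Phi^{d}\to R$ (with tables $\Phi\to R$). The function $h$ is *$k$-unique* on $U$ if every non-empty $X\subseteq U$ with $|X|\le k$ contains a key $x$ for which there is a position $j$ with $h(y)_j\ne h(x)_j$ for all $y\in X\setminus\{x\}$. A family of hash functions $U\to R$ with a uniformly random seed is *$k$-independent* if the hash values of any at most $k$ distinct keys are independent random variables and every single hash value is uniform in $R$. The *universal probability* of an event is its probability over uniformly random tables of $h$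 alone, which are then fixed once and for all. **Statement.** There are absolute constants $A\in\mathbb N$, $\delta>0$ and a fixed word RAM program $P$ such that the following holds. Let $u\to\infty$ and let $c\ge 1$ be natural numbers (varying with $u$) with $c^{\,c^2}=u^{o(1)}$. Then there are natural numbers $n,d,b,k,S$ (depending on $u$ and $c$) with, for all sufficiently large $u$, $u\le 2^{bn}$ and $k\ge u^{\delta/c^2}$ (so $k=u^{\Omega(1/c^2)}$), and with $S=o(u^{1/c})$, such that: 1. With universal probability $1-o(1/u^{1/c})$, the random $h:\Phi^{n}\to\Phi^{d}$ is $k$-unique on $U$ and, with this $h$ fixed, for every $\rho$, double tabulation $r\circ h$ with uniformly random tables of $r$ is a $k$-independent hash family from $U$ to $R=[2^\rho]$. 2. For all sufficiently large $u$, for every word length $w$ such that keys and hash values fit in one word ($u\le 2^w$ and $\rho\le w$), and for all tables of $h$ and $r$, there is a representation of $r\circ h$ in a memory of $S$ words of $w$ bits from which $P$ computes $r(h(x))$, for every key $x\in U$, in at most $A\,c$ steps, using no memory beyond these $S$ words and its fixed number of registers. Here a word RAM step is one elementary operation on words (loading a constant, copying, addition, subtraction, multiplication, division, remainder, bit-wise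 and/or/xor, shifts, a comparison, or one read from or write to memory). -/

import Mathlib

open Filter Asymptotics Topology

namespace DoubleTab

/-! ### Simple and double tabulation

A character of `b` bits is a `BitVec b`; the alphabet `Φ` is `BitVec b`, so `|Φ| = 2 ^ b`.
The range `R = [2 ^ ρ]` is `BitVec ρ`, and `^^^` is bit-wise exclusive-or. -/

/-- The exclusive-or of `f 0, …, f (n - 1)`. -/
def xorSum {n m : ℕ} (f : Fin n → BitVec m) : BitVec m :=
  (List.ofFn f).foldr (fun a s => a ^^^ s) 0

/-- Simple tabulation with character tables `t 0, …, t (n - 1)`. -/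
def simpleTab {n b m : ℕ} (t : Fin n → BitVec b → BitVec m) (x : Fin n → BitVec b) : BitVec m :=
  xorSum fun i => t i (x i)

/-- Simple tabulation whose hash values are vectors of `d` characters (xor acts on each of them). -/
def simpleTabVec {n b d m : ℕ} (h : Fin n → BitVec b → Fin d → BitVec m) (x : Fin n → BitVec b) :
    Fin d → BitVec m :=
  fun j => simpleTab (fun i a => h i a j) x

/-- The key `x`, viewed as a vector of `n` characters of `b` bits
(`BitVec.ofNat b` reduces modulo `2 ^ b`; distinct keys below `2 ^ (b * n)` get distinct vectors). -/
def chars (b n x : ℕ) : Fin n → BitVec b :=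
  fun i => BitVec.ofNat b (x / 2 ^ (b * (i : ℕ)))

/-- The tables of the first simple tabulation function `h : Φ ^ n → Φ ^ d`, `Φ = BitVec b`. -/
abbrev FirstTables (b n d : ℕ) : Type := Fin n → BitVec b → Fin d → BitVec b

/-- The tables of the second simple tabulation function `r : Φ ^ d → R`, `R = BitVec ρ`. -/
abbrev SecondTables (b d ρ : ℕ) : Type := Fin d → BitVec b → BitVec ρ

/-- The first simple tabulation function as a function on the universe `U = [u]`. -/
def firstTab {b n d : ℕ} (u : ℕ) (h : FirstTables b n d) (x : Fin u) : Fin d → BitVec b :=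
  simpleTabVec h (chars b n x)

/-- Double tabulation `r ∘ h : U → R`. -/
def doubleTab {b n d ρ : ℕ} (u : ℕ) (h : FirstTables b n d) (r : SecondTables b d ρ) (x : Fin u) :
    BitVec ρ :=
  simpleTab r (firstTab u h x)

/-! ### Uniqueness and independence -/

/-- The uniform probability of an event in a finite probability space. -/
noncomputable def unifProb {Ω : Type} (E : Set Ω) : ℝ :=
  letI : MeasurableSpace Ω := ⊤
  (ProbabilityTheory.uniformOn (Set.univ : Set Ω)).real E

/-- `f` is `k`-unique: every non-empty key set `X` of at most `k` keys has a unique output position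
character `(j, f x j)`. -/
def IsKUnique {U Ψ : Type} {d : ℕ} (k : ℕ) (f : U → Fin d → Ψ) : Prop :=
  ∀ X : Finset U, X.Nonempty → X.card ≤ k →
    ∃ x ∈ X, ∃ j : Fin d, ∀ y ∈ X, y ≠ x → f y j ≠ f x j

/-- The family `(H ω)`, with `ω` uniform in the finite seed set `Ω`, is `k`-independent: the hash
values of any at most `k` distinct keys are independent random variables, and each hash value is
uniformly distributed in `R`. -/
def IsKIndependent {Ω U R : Type} (k : ℕ) (H : Ω → U → R) : Prop :=
  letI : MeasurableSpace Ω := ⊤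
  letI : MeasurableSpace R := ⊤
  (∀ X : Finset U, X.card ≤ k →
    ProbabilityTheory.iIndepFun (fun (x : X) (ω : Ω) => H ω x)
      (ProbabilityTheory.uniformOn Set.univ)) ∧
  ∀ x : U, (ProbabilityTheory.uniformOn (Set.univ : Set Ω)).map (fun ω => H ω x) =
    ProbabilityTheory.uniformOn (Set.univ : Set R)

/-- The first tables `h` are good for independence `k`: `h` is `k`-unique on `U`, and with this
fixed `h`, for every range `R = [2 ^ ρ]`, double tabulation with uniformly random second tables is
a `k`-independent hash family from `U` to `R`. -/
def IsUniversal {b n d : ℕ} (u k : ℕ) (h : FirstTables b n d) : Prop :=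
  IsKUnique k (firstTab u h) ∧
  ∀ ρ : ℕ, IsKIndependent k fun r : SecondTables b d ρ => doubleTab u h r

/-! ### The word RAM

Words have `w` bits. The machine has word registers, addressed by literals of the program (so that
a fixed program uses a fixed number of them), and a random access memory of `S` words. -/

structure State (w S : ℕ) where
  reg : ℕ → BitVec w
  mem : Fin S → BitVec w

/-- Unsigned word operations of a standard programming language. -/
inductive BinOp
  | add | sub | mul | div | mod | and | or | xor | shl | shr

def BinOp.eval {w : ℕ} : BinOp → BitVec w → BitVec w → BitVec w
  | .add, x, y => x + y
  | .sub, x, y => x - y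
  | .mul, x, y => x * y
  | .div, x, y => x / y
  | .mod, x, y => x % y
  | .and, x, y => x &&& y
  | .or, x, y => x ||| y
  | .xor, x, y => x ^^^ y
  | .shl, x, y => x <<< y.toNat
  | .shr, x, y => x >>> y.toNat

/-- Programs. Natural numbers name registers, except for the literal `v` in `const`. -/
inductive Cmd
  | skip
  | const (dst v : ℕ)
  | move (dst src : ℕ)
  | op (o : BinOp) (dst a b : ℕ)
  | load (dst addr : ℕ)
  | store (addr src : ℕ)
  | seq (P Q : Cmd)
  | branch (a b : ℕ) (P Q : Cmd)
  | loop (a b : ℕ) (P : Cmd)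

def State.setReg {w S : ℕ} (s : State w S) (i : ℕ) (v : BitVec w) : State w S :=
  { s with reg := Function.update s.reg i v }

def State.setMem {w S : ℕ} (s : State w S) (i : Fin S) (v : BitVec w) : State w S :=
  { s with mem := Function.update s.mem i v }

/-- `Exec P s t s'`: started in `s`, the program `P` halts in `s'` after `t` steps. Every elementary
instruction and every evaluated test `reg a < reg b` takes one step. An access to an address
outside the `S` memory words has no successor. -/
inductive Exec {w S : ℕ} : Cmd → State w S → ℕ → State w S → Prop
  | skip (s : State w S) : Exec .skip s 1 s
  | const (s : State w S) (dst v : ℕ) :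
      Exec (.const dst v) s 1 (s.setReg dst (BitVec.ofNat w v))
  | move (s : State w S) (dst src : ℕ) : Exec (.move dst src) s 1 (s.setReg dst (s.reg src))
  | op (s : State w S) (o : BinOp) (dst a b : ℕ) :
      Exec (.op o dst a b) s 1 (s.setReg dst (o.eval (s.reg a) (s.reg b)))
  | load (s : State w S) (dst addr : ℕ) (hS : (s.reg addr).toNat < S) :
      Exec (.load dst addr) s 1 (s.setReg dst (s.mem ⟨(s.reg addr).toNat, hS⟩))
  | store (s : State w S) (addr src : ℕ) (hS : (s.reg addr).toNat < S) :
      Exec (.store addr src) s 1 (s.setMem ⟨(s.reg addr).toNat, hS⟩ (s.reg src))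
  | seq {P Q : Cmd} {s s' s'' : State w S} {t t' : ℕ} :
      Exec P s t s' → Exec Q s' t' s'' → Exec (.seq P Q) s (t + t') s''
  | branch_true {a b : ℕ} {P Q : Cmd} {s s' : State w S} {t : ℕ} :
      (s.reg a).toNat < (s.reg b).toNat → Exec P s t s' → Exec (.branch a b P Q) s (t + 1) s'
  | branch_false {a b : ℕ} {P Q : Cmd} {s s' : State w S} {t : ℕ} :
      ¬ (s.reg a).toNat < (s.reg b).toNat → Exec Q s t s' → Exec (.branch a b P Q) s (t + 1) s'
  | loop_true {a b : ℕ} {P : Cmd} {s s' s'' : State w S} {t t' : ℕ} :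
      (s.reg a).toNat < (s.reg b).toNat → Exec P s t s' → Exec (.loop a b P) s' t' s'' →
      Exec (.loop a b P) s (t + t' + 1) s''
  | loop_false {a b : ℕ} {P : Cmd} {s : State w S} :
      ¬ (s.reg a).toNat < (s.reg b).toNat → Exec (.loop a b P) s 1 s

/-- A query: the memory holds `M`, the key `x` is in register `0`, all other registers are `0`. -/
def queryState {w S : ℕ} (M : Fin S → BitVec w) (x : ℕ) : State w S where
  reg := fun i => if i = 0 then BitVec.ofNat w x else 0
  mem := M

/-- With words of `w` bits, the program `P` evaluates the hash function `f : [u] → [2 ^ ρ]` in at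
most `T` steps per key, from a representation of `f` and with a memory of `S` words in total. The
hash value is left in register `0`. -/
def Evaluates {u ρ : ℕ} (P : Cmd) (w S T : ℕ) (f : Fin u → BitVec ρ) : Prop :=
  ∃ M : Fin S → BitVec w, ∀ x : Fin u, ∃ (t : ℕ) (s : State w S),
    t ≤ T ∧ Exec P (queryState M x) t s ∧ s.reg 0 = (f x).setWidth w

/-! ### Asymptotics -/

/-- `f = u ^ o(1)` along the filter `l`. -/
def IsPowLittleOOne {ι : Type} (l : Filter ι) (f u : ι → ℝ) : Prop :=
  ∃ e : ι → ℝ, Tendsto e l (𝓝 0) ∧ ∀ᶠ i in l, f i = u i ^ e i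

end DoubleTab

/-! The parameters are `n = 2c`, `d = 32n = 64c`, `B = 2 ^ b` about `u ^ (1/(2c))` and `k` about `u
^ (1/(32c²))`.

Independence is linear algebra over the xor group. For fixed `h`, the hash values of a key set are
sums of entries of the tables of `r`. If `h` is `k`-unique, these sums form a system in which every
non-empty subset of equations has one with a private variable (`Peelable`). Such a system is
solvable for every right-hand side, and all fibres have the same size, so the values are uniform and
independent (`IsKUnique.isKIndependent_doubleTab`).

It remains to bound the probability that `h` is not `k`-unique. In a bad set `X`, every key collides
with another one at each output position `j`, and a collision says that the `j`-th table values over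
the symmetric difference of the two keys' position characters sum to zero. Rank the characters by
decreasing frequency in `X`, and call the character of largest rank in the symmetric difference the
leading one. For each `j`, at least half of the keys contain a character that leads a relation at
`j`. Averaging over frequency levels gives a set `A` of the most frequent characters carrying at
least `d|A|/(2n) = 16|A|` pairs of leading character and position; since leading characters are the
rarest in their relations, these relations stay inside `A` (`exists_dense_relations`). The system is
triangular, so it holds with probability exactly `B ^ (-|T|)` (`IsRelationSystem.unifProb_eq`). A
union bound over all encodings of such systems leaves `B ^ (-5)` (`unifProb_not_isKUnique_le`),
which is `o(u ^ (-1/c))`.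

For speed, the `64c` intermediate characters are split into 64 groups of `c`. One group fits in a
word, so `2c` look-ups of packed entries compute it and `c` more apply `r`: `O(c)` steps in all
rather than order `nd`. The space is `O(c B)`. The hypothesis on `c` enters only as `c² log (4c) =
o(log u)`, which absorbs all factors depending on `c` (`eventually_mul_log_le`). -/

namespace DoubleTab

/-! ### Bit strings as an elementary abelian 2-group -/

/-- Bit strings of length `m` with exclusive-or as addition. -/
def XorGroup (m : ℕ) : Type := BitVec m

namespace XorGroup

/-- A bit string as an element of the group. -/
def ofBits {m : ℕ} : BitVec m ≃ XorGroup m := Equiv.refl _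

instance (m : ℕ) : Zero (XorGroup m) := ⟨ofBits 0⟩

instance (m : ℕ) : Add (XorGroup m) := ⟨fun x y => ofBits (ofBits.symm x ^^^ ofBits.symm y)⟩

instance (m : ℕ) : Neg (XorGroup m) := ⟨fun x => x⟩

instance (m : ℕ) : AddCommGroup (XorGroup m) where
  add_assoc x y z := BitVec.xor_assoc x y z
  zero_add x := BitVec.zero_xor
  add_zero x := BitVec.xor_zero
  neg_add_cancel x := BitVec.xor_self
  add_comm x y := BitVec.xor_comm x y
  nsmul := nsmulRec
  zsmul := zsmulRec

instance (m : ℕ) : Finite (XorGroup m) := Finite.of_equiv _ ofBits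

theorem card (m : ℕ) : Nat.card (XorGroup m) = 2 ^ m := by
  rw [← Nat.card_congr ofBits, Nat.card_congr BitVec.equivFin.toEquiv, Nat.card_fin]

theorem ofBits_xor {m : ℕ} (x y : BitVec m) : ofBits (x ^^^ y) = ofBits x + ofBits y := rfl

theorem add_self {m : ℕ} (x : XorGroup m) : x + x = 0 := neg_add_cancel x

end XorGroup

theorem xorSum_succ {n m : ℕ} (f : Fin (n + 1) → BitVec m) :
    xorSum f = f 0 ^^^ xorSum (fun i : Fin n => f i.succ) := by
  simp [xorSum, List.ofFn_succ]

theorem ofBits_xorSum {n m : ℕ} (f : Fin n → BitVec m) :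
    XorGroup.ofBits (xorSum f) = ∑ i, XorGroup.ofBits (f i) := by
  induction n with
  | zero => rfl
  | succ n ih =>
    rw [Fin.sum_univ_succ, xorSum_succ, XorGroup.ofBits_xor, ih]

/-- Common terms cancel in pairs. This turns a collision of two keys into a vanishing sum over the
characters in which they differ. -/
theorem XorGroup.sum_symmDiff {α : Type*} [DecidableEq α] {m : ℕ} (s t : Finset α)
    (f : α → XorGroup m) : ∑ a ∈ symmDiff s t, f a = ∑ a ∈ s, f a + ∑ a ∈ t, f a := by
  have hd : Disjoint (s \ t) (t \ s) := by
    rw [Finset.disjoint_left]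
    intro a ha hb
    exact (Finset.mem_sdiff.1 ha).2 (Finset.mem_sdiff.1 hb).1
  have h1 := Finset.sum_inter_add_sum_sdiff s t f
  have h2 := Finset.sum_inter_add_sum_sdiff t s f
  rw [Finset.inter_comm] at h2
  rw [symmDiff_def, Finset.sup_eq_union, Finset.sum_union hd, ← h1, ← h2]
  have := XorGroup.add_self (∑ a ∈ s ∩ t, f a)
  calc _ = (∑ a ∈ s ∩ t, f a + ∑ a ∈ s ∩ t, f a) + (∑ x ∈ s \ t, f x + ∑ x ∈ t \ s, f x) := by
        rw [this, zero_add]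
    _ = _ := by abel

/-! ### Peelable systems of equations -/

/-- In every non-empty set of the given equations, some equation has a variable of its own. -/
def Peelable {T V : Type*} (D : T → Finset V) (X : Finset T) : Prop :=
  ∀ Y ⊆ X, Y.Nonempty → ∃ t ∈ Y, ∃ v ∈ D t, ∀ s ∈ Y, s ≠ t → v ∉ D s

/-- Back substitution: solve all equations but the one with a private variable, then adjust that
variable, which disturbs no other equation. -/
theorem Peelable.exists_solution {T V G : Type*} [AddCommGroup G] {D : T → Finset V}
    {X : Finset T} (hD : Peelable D X) (y : T → G) :
    ∃ a : V → G, ∀ t ∈ X, ∑ v ∈ D t, a v = y t := by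
  classical
  induction X using Finset.strongInduction with
  | H X ih =>
    rcases X.eq_empty_or_nonempty with rfl | hX
    · exact ⟨0, by simp⟩
    obtain ⟨t, ht, v, hv, huniq⟩ := hD X subset_rfl hX
    obtain ⟨a, ha⟩ := ih (X.erase t) (Finset.erase_ssubset ht)
      (fun Y hY hne => hD Y (hY.trans (Finset.erase_subset t X)) hne)
    refine ⟨Function.update a v (y t - ∑ v' ∈ D t \ {v}, a v'), fun s hs => ?_⟩
    by_cases hst : s = t
    · subst hst
      rw [Finset.sum_update_of_mem hv]
      abel
    · rw [Finset.sum_update_of_notMem (huniq s hs hst)]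
      exact ha s (Finset.mem_erase.2 ⟨hst, hs⟩)

/-- The left-hand sides define a group homomorphism, surjective by `Peelable.exists_solution`, so
all its fibres have equal size. -/
theorem Peelable.card_solutions {T V G : Type*} [Fintype T] [Fintype V] [AddCommGroup G] [Finite G]
    {D : T → Finset V} (hD : Peelable D Finset.univ) (y : T → G) :
    Nat.card {a : V → G // ∀ t, ∑ v ∈ D t, a v = y t} * Nat.card G ^ Fintype.card T =
      Nat.card G ^ Fintype.card V := by
  classical
  have := Fintype.ofFinite G
  let F : (V → G) →+ (T → G) :=
    { toFun := fun a t => ∑ v ∈ D t, a v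
      map_zero' := by ext; simp
      map_add' := fun a a' => by ext; simp [Finset.sum_add_distrib] }
  have hF : Function.Surjective F := fun z => by
    obtain ⟨a, ha⟩ := hD.exists_solution z
    exact ⟨a, funext fun t => ha t (Finset.mem_univ t)⟩
  have hfib : ∀ z : T → G, (Finset.univ.filter fun a => F a = z).card =
      (Finset.univ.filter fun a => F a = y).card := fun z =>
    AddMonoidHom.card_fiber_eq_of_mem_range F (hF z) (hF y)
  have hsum := Finset.card_eq_sum_card_fiberwise (f := F) (s := Finset.univ) (t := Finset.univ)
    (fun _ _ => Finset.mem_coe.2 (Finset.mem_univ _))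
  simp only [hfib, Finset.sum_const, Finset.card_univ, Fintype.card_fun, smul_eq_mul] at hsum
  have hy : Nat.card {a : V → G // ∀ t, ∑ v ∈ D t, a v = y t} =
      (Finset.univ.filter fun a => F a = y).card := by
    rw [Nat.card_eq_fintype_card, Fintype.card_subtype]
    congr 1
    ext a
    simp [F, funext_iff]
  rw [hy, Nat.card_eq_fintype_card, hsum, mul_comm]

/-! ### Uniform probabilities as counts -/

open MeasureTheory ProbabilityTheory

theorem unifProb_eq_card_div_card {Ω : Type} [Finite Ω] (E : Set Ω) :
    unifProb E = Nat.card E / Nat.card Ω := by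
  have := Fintype.ofFinite Ω
  let _ : MeasurableSpace Ω := ⊤
  rw [unifProb, Measure.real, uniformOn_univ, Measure.count_apply MeasurableSpace.measurableSet_top]
  have : (E.encard : ENNReal) = ((E.ncard : ℕ) : ENNReal) := by
    rw [← E.toFinite.cast_ncard_eq]
    rfl
  simp [this]

/-- The counts give every point of the joint law the mass `|R| ^ (-|X|)`; singletons `X` give the
marginals, and measures on these finite spaces are determined by their point masses. -/
theorem isKIndependent_of_card {Ω U R : Type} [Finite Ω] [Nonempty Ω] [Finite R] [Nonempty R]
    {k : ℕ} (hk : 1 ≤ k) {H : Ω → U → R}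
    (h : ∀ X : Finset U, X.card ≤ k → ∀ y : X → R,
      Nat.card {ω // ∀ x : X, H ω x = y x} * Nat.card R ^ X.card = Nat.card Ω) :
    IsKIndependent k H := by
  classical
  have := Fintype.ofFinite Ω
  have := Fintype.ofFinite R
  let _ : MeasurableSpace Ω := ⊤
  let _ : MeasurableSpace R := ⊤
  have hΩ : (Nat.card Ω : ENNReal) ≠ 0 := by simp
  have meas : ∀ X : Finset U, X.card ≤ k → ∀ y : X → R,
      uniformOn (Set.univ : Set Ω) {ω | ∀ x : X, H ω x = y x} =
        (Nat.card R : ENNReal)⁻¹ ^ X.card := by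
    intro X hX y
    rw [uniformOn_univ, Measure.count_apply MeasurableSpace.measurableSet_top,
      ← Nat.card_eq_fintype_card, ← h X hX y]
    have hc : (Set.encard {ω | ∀ x : X, H ω x = y x} : ENNReal) =
        ((Nat.card {ω // ∀ x : X, H ω x = y x} : ℕ) : ENNReal) := by
      rw [← (Set.toFinite _).cast_ncard_eq]
      rfl
    have hne : (Nat.card {ω // ∀ x : X, H ω x = y x} : ENNReal) ≠ 0 := by
      intro h0
      have := h X hX y
      rw [Nat.cast_eq_zero.1 h0, zero_mul] at this
      exact hΩ (by rw [← this]; simp)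
    rw [hc, Nat.cast_mul, Nat.cast_pow, ENNReal.div_eq_inv_mul,
      ENNReal.mul_inv (Or.inl hne) (Or.inl (ENNReal.natCast_ne_top _)), mul_right_comm,
      ENNReal.inv_mul_cancel hne (ENNReal.natCast_ne_top _), one_mul, ENNReal.inv_pow]
  have meas1 : ∀ (x : U) (y : R),
      uniformOn (Set.univ : Set Ω) {ω | H ω x = y} = (Nat.card R : ENNReal)⁻¹ := by
    intro x y
    have := meas {x} (by simpa using hk) (fun _ => y)
    simpa using this
  refine ⟨fun X hX => ?_, fun x => ?_⟩
  · rw [iIndepFun_iff_map_fun_eq_pi_map (fun x => (measurable_from_top).aemeasurable)]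
    have hp : ∀ x : X, IsProbabilityMeasure
        (Measure.map (fun ω => H ω x) (uniformOn (Set.univ : Set Ω))) := fun x =>
      Measure.isProbabilityMeasure_map measurable_from_top.aemeasurable
    rw [Measure.ext_iff_singleton]
    intro y
    rw [Measure.pi_singleton, Measure.map_apply measurable_from_top (measurableSet_singleton _)]
    have e1 : (fun ω (x : X) => H ω x) ⁻¹' {y} = {ω | ∀ x : X, H ω x = y x} := by
      ext ω; simp [funext_iff]
    rw [e1, meas X hX y]
    have e2 : ∀ x : X, (Measure.map (fun ω => H ω x) (uniformOn (Set.univ : Set Ω))) {y x} =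
        (Nat.card R : ENNReal)⁻¹ := by
      intro x
      rw [Measure.map_apply measurable_from_top (measurableSet_singleton _), ← meas1 x (y x)]
      rfl
    simp [e2]
  · rw [Measure.ext_iff_singleton]
    intro y
    rw [Measure.map_apply measurable_from_top (measurableSet_singleton _),
      uniformOn_univ (Ω := R), ← Nat.card_eq_fintype_card, Measure.count_singleton, one_div,
      ← meas1 x y]
    rfl

/-! ### Uniqueness gives independence -/

theorem ofBits_doubleTab {b n d ρ : ℕ} (u : ℕ) (h : FirstTables b n d) (r : SecondTables b d ρ)
    (x : Fin u) :
    XorGroup.ofBits (doubleTab u h r x) = ∑ j, XorGroup.ofBits (r j (firstTab u h x j)) :=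
  ofBits_xorSum _

/-- Each key is an equation in the table entries `(j, character)`; a unique output position
character is a private variable. -/
theorem IsKUnique.isKIndependent_doubleTab {b n d u k : ℕ} (hk : 1 ≤ k) {h : FirstTables b n d}
    (hu : IsKUnique k (firstTab u h)) (ρ : ℕ) :
    IsKIndependent k fun r : SecondTables b d ρ => doubleTab u h r := by
  classical
  refine isKIndependent_of_card hk fun X hX y => ?_
  let D : X → Finset (Fin d × BitVec b) := fun x =>
    Finset.univ.image fun j => (j, firstTab u h x j)
  have hD : Peelable D Finset.univ := by
    intro Y _ hY
    obtain ⟨x, hx, j, hj⟩ := hu (Y.map (Function.Embedding.subtype _)) (hY.map)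
      ((Finset.card_map _).trans_le ((Finset.card_le_univ Y).trans (by simpa using hX)))
    obtain ⟨x, hxY, rfl⟩ := Finset.mem_map.1 hx
    refine ⟨x, hxY, (j, firstTab u h x j), Finset.mem_image_of_mem _ (Finset.mem_univ j), ?_⟩
    intro s hs hne hmem
    obtain ⟨j', _, hj'⟩ := Finset.mem_image.1 hmem
    rw [Prod.mk.injEq] at hj'
    obtain ⟨rfl, hj'⟩ := hj'
    exact hj s (Finset.mem_map_of_mem _ hs) (fun e => hne (Subtype.ext e)) hj'
  have key := hD.card_solutions (G := XorGroup ρ) fun x => XorGroup.ofBits (y x)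
  have hR : Nat.card (BitVec ρ) = Nat.card (XorGroup ρ) := Nat.card_congr XorGroup.ofBits
  let φ : SecondTables b d ρ ≃ (Fin d × BitVec b → XorGroup ρ) :=
    (Equiv.curry (Fin d) (BitVec b) (BitVec ρ)).symm.trans (Equiv.arrowCongr (Equiv.refl _)
      XorGroup.ofBits)
  have e : Nat.card {r : SecondTables b d ρ // ∀ x : X, doubleTab u h r x = y x} =
      Nat.card {a : Fin d × BitVec b → XorGroup ρ //
        ∀ x, ∑ v ∈ D x, a v = XorGroup.ofBits (y x)} := by
    refine Nat.card_congr (φ.subtypeEquiv ?_)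
    intro r
    refine forall_congr' fun x => ?_
    rw [← XorGroup.ofBits.apply_eq_iff_eq, ofBits_doubleTab,
      Finset.sum_image (fun i _ j _ hij => (Prod.mk.inj hij).1)]
    rfl
  rw [e, hR, ← Fintype.card_coe X, key, Nat.card_congr φ, Nat.card_fun,
    Nat.card_eq_fintype_card (α := Fin d × BitVec b)]

/-! ### Dense systems of relations in sets without unique output characters -/

/-- Layer-cake averaging: both weighted sums are sums over the levels `s` of the corresponding
unweighted ones, so the inequality must hold on some non-empty level set. -/
theorem exists_superlevel_of_weighted_sum {C : Type*} [Fintype C] (w ρ : C → ℕ) (p q : ℕ)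
    (hw : ∃ a, 0 < w a) (h : p * ∑ a, w a ≤ q * ∑ a, w a * ρ a) :
    ∃ s, (∃ a, s < w a) ∧ p * (Finset.univ.filter fun a => s < w a).card ≤
      q * ∑ a ∈ Finset.univ.filter (fun a => s < w a), ρ a := by
  classical
  by_contra! hcon
  obtain ⟨a₀, ha₀⟩ := hw
  set M := ∑ a, w a
  have hM : ∀ a, w a ≤ M := fun a => Finset.single_le_sum (fun _ _ => Nat.zero_le _)
    (Finset.mem_univ a)
  have hlayer : ∀ a, ∀ r : ℕ, w a * r = ∑ s ∈ Finset.range M, if s < w a then r else 0 := by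
    intro a r
    rw [← Finset.sum_filter, Finset.sum_const, smul_eq_mul]
    congr 1
    rw [show (Finset.range M).filter (fun s => s < w a) = Finset.range (w a) from ?_,
      Finset.card_range]
    ext s
    have := hM a
    simp only [Finset.mem_filter, Finset.mem_range]
    omega
  have h1 : ∑ a, w a * ρ a =
      ∑ s ∈ Finset.range M, ∑ a ∈ Finset.univ.filter (fun a => s < w a), ρ a := by
    simp_rw [hlayer, Finset.sum_filter]
    exact Finset.sum_comm
  have h2 : M = ∑ s ∈ Finset.range M, (Finset.univ.filter fun a => s < w a).card := by
    simp_rw [Finset.card_filter]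
    rw [Finset.sum_comm]
    exact Finset.sum_congr rfl fun a _ => by rw [← hlayer, mul_one]
  have h3 : q * ∑ a, w a * ρ a < p * M := by
    rw [h1]
    conv_rhs => rw [h2]
    rw [Finset.mul_sum, Finset.mul_sum]
    -- Empty levels contribute zero to both sides; level `0` is non-empty and gives strictness.
    refine Finset.sum_lt_sum (fun s _ => ?_)
      ⟨0, Finset.mem_range.2 (ha₀.trans_le (hM a₀)), hcon 0 ⟨a₀, ha₀⟩⟩
    by_cases hs : ∃ a, s < w a
    · exact (hcon s hs).le
    · push Not at hs
      rw [Finset.filter_false_of_mem fun a _ => not_lt.2 (hs a)]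
      simp
  exact absurd h (not_le.2 h3)

/-- Some injective rank function lists the elements in order of decreasing weight. -/
theorem exists_rank_antitone {C : Type*} [Fintype C] (w : C → ℕ) :
    ∃ rk : C → ℕ, Function.Injective rk ∧ ∀ a a', rk a ≤ rk a' → w a' ≤ w a := by
  set M := ∑ a, w a
  have hM : ∀ a, w a ≤ M := fun a => Finset.single_le_sum (fun _ _ => Nat.zero_le _)
    (Finset.mem_univ a)
  set N := Fintype.card C
  let e : C ≃ Fin N := Fintype.equivFin C
  have key : ∀ a a', w a < w a' →
      (M - w a') * N + (e a' : ℕ) < (M - w a) * N + (e a : ℕ) := by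
    intro a a' h
    have h1 : M - w a' + 1 ≤ M - w a := by have := hM a'; omega
    have h2 := Nat.mul_le_mul_right N h1
    have h3 := (e a').isLt
    rw [add_mul] at h2
    omega
  -- Lexicographic order in base `N`: decreasing weight first, ties broken by the index `e a < N`.
  refine ⟨fun a => (M - w a) * N + e a, fun a a' h => ?_, fun a a' h => ?_⟩
  · have hw : w a = w a' := by
      rcases lt_trichotomy (w a) (w a') with hlt | heq | hgt
      · exact absurd h (key a a' hlt).ne'
      · exact heq
      · exact absurd h (key a' a hgt).ne
    simp only [hw] at h
    exact e.injective (Fin.ext (by omega))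
  · by_contra! hlt
    exact absurd h (not_le.2 (key a a' hlt))

/-- Of two distinct colliding keys, the one containing the top-ranked character of the symmetric
difference lies in `Y`. So each collision class has at most one key outside `Y`, and that key has a
partner inside. -/
theorem two_mul_card_dominated_ge {U C Ψ : Type*} [DecidableEq U] [DecidableEq C]
    {K : U → Finset C} (hKinj : Function.Injective K) (f : U → Ψ) (X : Finset U)
    (hbad : ∀ x ∈ X, ∃ y ∈ X, y ≠ x ∧ f y = f x) (rk : C → ℕ) (Y : Finset U) (hYX : Y ⊆ X)
    (hY : ∀ x ∈ X, ∀ y ∈ X, f y = f x → ∀ a ∈ K x, a ∈ symmDiff (K x) (K y) →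
      (∀ b ∈ symmDiff (K x) (K y), rk b ≤ rk a) → x ∈ Y) :
    X.card ≤ 2 * Y.card := by
  have hmax : ∀ x ∈ X, ∀ y ∈ X, f y = f x → y ≠ x → x ∈ Y ∨ y ∈ Y := by
    intro x hx y hy hf hne
    have hnon : (symmDiff (K x) (K y)).Nonempty := by
      rw [Finset.nonempty_iff_ne_empty, ← Finset.bot_eq_empty, Ne, symmDiff_eq_bot]
      exact fun h => hne (hKinj h).symm
    obtain ⟨a, ha, hmax⟩ := Finset.exists_max_image _ rk hnon
    rcases Finset.mem_symmDiff.1 ha with h | h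
    · exact Or.inl (hY x hx y hy hf a h.1 ha hmax)
    · rw [symmDiff_comm] at ha hmax
      exact Or.inr (hY y hy x hx hf.symm a h.1 ha hmax)
  have hp : ∀ x, ∃ y, x ∈ X → y ∈ X ∧ y ≠ x ∧ f y = f x := by
    intro x
    by_cases hx : x ∈ X
    · obtain ⟨y, hy⟩ := hbad x hx
      exact ⟨y, fun _ => hy⟩
    · exact ⟨x, fun h => absurd h hx⟩
  choose g hg using hp
  have hcard : (X \ Y).card ≤ Y.card := by
    -- Two keys with the same partner collide with each other, so they cannot both lie outside `Y`.
    refine Finset.card_le_card_of_injOn g (fun x hx => ?_) (fun x hx x' hx' hxx => ?_)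
    · obtain ⟨hxX, hxY⟩ := Finset.mem_sdiff.1 hx
      obtain ⟨h1, h2, h3⟩ := hg x hxX
      exact (hmax x hxX _ h1 h3 h2).resolve_left hxY
    · obtain ⟨hxX, hxY⟩ := Finset.mem_sdiff.1 hx
      obtain ⟨hxX', hxY'⟩ := Finset.mem_sdiff.1 hx'
      by_contra hne
      have hf : f x' = f x := by
        rw [← (hg x hxX).2.2, ← (hg x' hxX').2.2, hxx]
      exact (hmax x hxX x' hxX' hf (Ne.symm hne)).elim hxY hxY'
  have := Finset.card_sdiff_add_card_eq_card hYX
  omega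

/-- For each `j`, the leading characters cover at least half of `X`, so their frequencies sum to at
least `|X| / 2`. All frequencies together sum to `n |X|`; hence leading pairs have density at least
`d / (2n)` per character, weighted by frequency, and some frequency level attains this unweighted.
-/
theorem exists_dense_relations {U C Ψ : Type*} [DecidableEq C] [Fintype C] {n d : ℕ} (hn : 0 < n)
    {K : U → Finset C} (hKinj : Function.Injective K) (hK : ∀ x, (K x).card = n)
    (f : U → Fin d → Ψ) {X : Finset U} (hX : X.Nonempty)
    (hbad : ∀ x ∈ X, ∀ j, ∃ y ∈ X, y ≠ x ∧ f y j = f x j) :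
    ∃ rk : C → ℕ, Function.Injective rk ∧ ∃ A : Finset C, A.Nonempty ∧ A ⊆ X.biUnion K ∧
      ∃ T : Finset (C × Fin d), d * A.card ≤ 2 * n * T.card ∧ ∀ t ∈ T, t.1 ∈ A ∧
        ∃ x ∈ X, ∃ y ∈ X, f y t.2 = f x t.2 ∧ t.1 ∈ symmDiff (K x) (K y) ∧
          ∀ b ∈ symmDiff (K x) (K y), b ∈ A ∧ rk b ≤ rk t.1 := by
  classical
  let w : C → ℕ := fun a => (X.filter fun x => a ∈ K x).card
  obtain ⟨rk, hrk, hrkw⟩ := exists_rank_antitone w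
  let Rel : C × Fin d → U → U → Prop := fun t x y => f y t.2 = f x t.2 ∧
    t.1 ∈ symmDiff (K x) (K y) ∧ ∀ b ∈ symmDiff (K x) (K y), rk b ≤ rk t.1
  let R : Finset (C × Fin d) :=
    Finset.univ.filter fun t => ∃ x ∈ X, ∃ y ∈ X, Rel t x y
  let Y : Fin d → Finset U := fun j => X.filter fun x => ∃ a ∈ K x, (a, j) ∈ R
  have hY : ∀ j, X.card ≤ 2 * (Y j).card := by
    intro j
    refine two_mul_card_dominated_ge hKinj (fun x => f x j) X (fun x hx => hbad x hx j) rk (Y j)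
      (Finset.filter_subset _ _) ?_
    intro x hx y hy hf a ha has hmax
    exact Finset.mem_filter.2 ⟨hx, a, ha, Finset.mem_filter.2
      ⟨Finset.mem_univ _, x, hx, y, hy, hf, has, hmax⟩⟩
  have hYR : ∀ j, (Y j).card ≤ ∑ a, if (a, j) ∈ R then w a else 0 := by
    intro j
    rw [← Finset.sum_filter]
    refine (Finset.card_le_card ?_).trans (Finset.card_biUnion_le (s := Finset.univ.filter
      fun a => (a, j) ∈ R) (t := fun a => X.filter fun x => a ∈ K x))
    intro x hx
    obtain ⟨hx, a, ha, haR⟩ := Finset.mem_filter.1 hx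
    exact Finset.mem_biUnion.2 ⟨a, Finset.mem_filter.2 ⟨Finset.mem_univ _, haR⟩,
      Finset.mem_filter.2 ⟨hx, ha⟩⟩
  let ρ : C → ℕ := fun a => (Finset.univ.filter fun j => (a, j) ∈ R).card
  have hwsum : ∑ a, w a = n * X.card := by
    have := Finset.sum_card_bipartiteAbove_eq_sum_card_bipartiteBelow
      (fun (a : C) (x : U) => a ∈ K x) (s := Finset.univ) (t := X)
    simp only [Finset.bipartiteAbove, Finset.bipartiteBelow, Finset.filter_univ_mem, hK,
      Finset.sum_const, smul_eq_mul] at this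
    rw [mul_comm]
    exact this
  have hwρ : ∑ a, w a * ρ a = ∑ j, ∑ a, if (a, j) ∈ R then w a else 0 := by
    rw [Finset.sum_comm]
    refine Finset.sum_congr rfl fun a _ => ?_
    rw [← Finset.sum_filter, Finset.sum_const, smul_eq_mul, mul_comm]
  have hmain : d * ∑ a, w a ≤ (2 * n) * ∑ a, w a * ρ a := by
    have h1 : ∑ _j : Fin d, X.card ≤ ∑ j : Fin d, 2 * ∑ a, if (a, j) ∈ R then w a else 0 :=
      Finset.sum_le_sum fun j _ => (hY j).trans (Nat.mul_le_mul_left 2 (hYR j))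
    rw [← Finset.mul_sum, ← hwρ] at h1
    simp only [Finset.sum_const, Finset.card_univ, Fintype.card_fin, smul_eq_mul] at h1
    rw [hwsum]
    calc d * (n * X.card) = n * (d * X.card) := by ring
      _ ≤ n * (2 * ∑ a, w a * ρ a) := Nat.mul_le_mul_left n h1
      _ = _ := by ring
  have hwpos : ∃ a, 0 < w a := by
    obtain ⟨x, hx⟩ := hX
    obtain ⟨a, ha⟩ := Finset.card_pos.1 ((hK x).symm ▸ hn)
    exact ⟨a, Finset.card_pos.2 ⟨x, Finset.mem_filter.2 ⟨hx, ha⟩⟩⟩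
  obtain ⟨s, ⟨a₀, ha₀⟩, hs⟩ := exists_superlevel_of_weighted_sum w ρ d (2 * n) hwpos hmain
  refine ⟨rk, hrk, Finset.univ.filter fun a => s < w a, ⟨a₀, by simpa using ha₀⟩, ?_,
    R.filter fun t => s < w t.1, ?_, ?_⟩
  · intro a ha
    obtain ⟨x, hx⟩ := Finset.card_pos.1 ((Nat.zero_le s).trans_lt (Finset.mem_filter.1 ha).2)
    obtain ⟨hx, hax⟩ := Finset.mem_filter.1 hx
    exact Finset.mem_biUnion.2 ⟨x, hx, hax⟩
  · convert hs using 2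
    rw [Finset.card_eq_sum_card_fiberwise (f := Prod.fst)
      (t := Finset.univ.filter fun a => s < w a)
      (fun t ht => by simpa using (Finset.mem_filter.1 ht).2)]
    refine Finset.sum_congr rfl fun a ha => ?_
    refine Finset.card_bij (fun t _ => t.2) ?_ ?_ ?_
    · rintro ⟨a', j⟩ ht
      simp only [Finset.mem_filter] at ht
      obtain ⟨ht, rfl⟩ := ht
      exact Finset.mem_filter.2 ⟨Finset.mem_univ _, ht.1⟩
    · rintro ⟨a', j⟩ ht ⟨a'', j'⟩ ht' hj
      simp only [Finset.mem_filter] at ht ht' hj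
      rw [ht.2, ht'.2, hj]
    · intro j hj
      exact ⟨(a, j), Finset.mem_filter.2 ⟨Finset.mem_filter.2 ⟨(Finset.mem_filter.1 hj).2,
        (Finset.mem_filter.1 ha).2⟩, rfl⟩, rfl⟩
  · intro t ht
    obtain ⟨htR, hts⟩ := Finset.mem_filter.1 ht
    obtain ⟨-, x, hx, y, hy, hf, hm, hmax⟩ := Finset.mem_filter.1 htR
    -- A lower rank means at least the same frequency, so the whole relation lies in the superlevel
    -- set of its leading character.
    exact ⟨by simpa using hts, x, hx, y, hy, hf, hm, fun b hb =>
      ⟨Finset.mem_filter.2 ⟨Finset.mem_univ _, hts.trans_le (hrkw _ _ (hmax b hb))⟩, hmax b hb⟩⟩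

/-! ### Position characters -/

/-- The position characters `(i, x i)` of a key. -/
def posChars {n b : ℕ} (x : Fin n → BitVec b) : Finset (Fin n × BitVec b) :=
  Finset.univ.map ⟨fun i => (i, x i), fun _ _ h => (Prod.mk.inj h).1⟩

theorem mem_posChars {n b : ℕ} {x : Fin n → BitVec b} {a : Fin n × BitVec b} :
    a ∈ posChars x ↔ x a.1 = a.2 := by
  simp only [posChars, Finset.mem_map, Finset.mem_univ, true_and]
  constructor
  · rintro ⟨i, rfl⟩
    rfl
  · exact fun h => ⟨a.1, Prod.ext rfl h⟩

theorem card_posChars {n b : ℕ} (x : Fin n → BitVec b) : (posChars x).card = n := by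
  simp [posChars]

theorem posChars_injective {n b : ℕ} :
    Function.Injective (posChars : (Fin n → BitVec b) → Finset (Fin n × BitVec b)) := by
  intro x y h
  funext i
  have : (i, x i) ∈ posChars y := h ▸ mem_posChars.2 rfl
  exact (mem_posChars.1 this).symm

theorem chars_injOn {b n x y : ℕ} (hx : x < 2 ^ (b * n)) (hy : y < 2 ^ (b * n))
    (h : chars b n x = chars b n y) : x = y := by
  have key : ∀ m ≤ n, x % (2 ^ b) ^ m = y % (2 ^ b) ^ m := by
    intro m
    induction m with
    | zero => intro _; simp [Nat.mod_one]
    | succ m ih =>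
      intro hm
      have hc := congrArg BitVec.toNat (congrFun h ⟨m, hm⟩)
      simp only [chars, BitVec.toNat_ofNat, pow_mul] at hc
      rw [Nat.mod_pow_succ, Nat.mod_pow_succ, ih (by omega), hc]
  have := key n le_rfl
  rwa [← pow_mul, Nat.mod_eq_of_lt hx, Nat.mod_eq_of_lt hy] at this

theorem ofBits_firstTab {b n d u : ℕ} (h : FirstTables b n d) (x : Fin u) (j : Fin d) :
    XorGroup.ofBits (firstTab u h x j) =
      ∑ a ∈ posChars (chars b n x), XorGroup.ofBits (h a.1 a.2 j) := by
  rw [posChars, Finset.sum_map]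
  exact ofBits_xorSum _

/-! ### Systems of relations between position characters -/

/-- A system of relations between the position characters `α 0, …, α (p - 1)`: for `(i, j)` in `T`,
the `j`-th hash characters of `α q`, for `q` in the range of `g (i, j)`, sum to zero, and `i` is the
largest such `q`. -/
structure IsRelationSystem {b n d m p : ℕ} (α : Fin p → Fin n × BitVec b)
    (T : Finset (Fin p × Fin d)) (g : T → Fin m → Fin p) : Prop where
  inj : Function.Injective α
  mem : ∀ t : T, ∃ q, g t q = t.1.1
  le : ∀ t : T, ∀ q, g t q ≤ t.1.1

/-- The tables satisfy the relations. -/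
def Satisfies {b n d m p : ℕ} (α : Fin p → Fin n × BitVec b)
    (T : Finset (Fin p × Fin d)) (g : T → Fin m → Fin p) (h : FirstTables b n d) : Prop :=
  ∀ t : T, ∑ q ∈ Finset.univ.image (g t), XorGroup.ofBits (h (α q).1 (α q).2 t.1.2) = 0

/-- First tables as assignments of group elements to pairs of a position character and an output
position. -/
def firstTablesEquiv (b n d : ℕ) :
    FirstTables b n d ≃ ((Fin n × BitVec b) × Fin d → XorGroup b) where
  toFun h v := XorGroup.ofBits (h v.1.1 v.1.2 v.2)
  invFun a i c j := XorGroup.ofBits.symm (a ((i, c), j))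
  left_inv _ := rfl
  right_inv _ := rfl

/-- The relations are triangular: in any subset, one with the largest leading index owns its leading
variable, as `T` has only one relation per leading index and output position. Each relation then
costs a factor `2 ^ b`. -/
theorem IsRelationSystem.unifProb_eq {b n d m p : ℕ} {α : Fin p → Fin n × BitVec b}
    {T : Finset (Fin p × Fin d)} {g : T → Fin m → Fin p} (hg : IsRelationSystem α T g) :
    unifProb {h : FirstTables b n d | Satisfies α T g h} = ((2 ^ b : ℝ) ^ T.card)⁻¹ := by
  classical
  let D : T → Finset ((Fin n × BitVec b) × Fin d) := fun t =>
    (Finset.univ.image (g t)).image fun q => (α q, t.1.2)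
  have hD : Peelable D Finset.univ := by
    intro Y _ hY
    obtain ⟨t, ht, hmax⟩ := Finset.exists_max_image Y (fun t => t.1.1) hY
    obtain ⟨q, hq⟩ := hg.mem t
    refine ⟨t, ht, (α t.1.1, t.1.2), Finset.mem_image.2 ⟨t.1.1, Finset.mem_image.2
      ⟨q, Finset.mem_univ _, hq⟩, rfl⟩, fun s hs hne hmem => hne ?_⟩
    obtain ⟨q', hq', he⟩ := Finset.mem_image.1 hmem
    obtain ⟨q'', -, rfl⟩ := Finset.mem_image.1 hq'
    obtain ⟨he1, he2⟩ := Prod.mk.inj he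
    have h1 := hg.inj he1
    have h2 := hg.le s q''
    exact Subtype.ext (Prod.ext (le_antisymm (hmax s hs) (h1 ▸ h2)) he2)
  have key := hD.card_solutions (G := XorGroup b) 0
  have e : Nat.card {h : FirstTables b n d | Satisfies α T g h} =
      Nat.card {a : (Fin n × BitVec b) × Fin d → XorGroup b //
        ∀ t, ∑ v ∈ D t, a v = (0 : T → XorGroup b) t} := by
    refine Nat.card_congr ((firstTablesEquiv b n d).subtypeEquiv fun h => ?_)
    refine forall_congr' fun t => ?_
    rw [Finset.sum_image fun q _ q' _ hqq => hg.inj (Prod.mk.inj hqq).1]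
    rfl
  rw [unifProb_eq_card_div_card, e, Nat.card_congr (firstTablesEquiv b n d), Nat.card_fun,
    Nat.card_eq_fintype_card (α := (Fin n × BitVec b) × Fin d), ← key, XorGroup.card,
    Fintype.card_coe]
  have hpos : (Nat.card {a : (Fin n × BitVec b) × Fin d → XorGroup b //
        ∀ t, ∑ v ∈ D t, a v = (0 : T → XorGroup b) t} : ℝ) ≠ 0 := by
    intro h0
    rw [Nat.cast_eq_zero.1 h0, zero_mul, XorGroup.card] at key
    exact (pow_pos (pow_pos two_pos b) _).ne key
  push_cast
  field_simp

/-- Encodes the dense relations of a bad key set by data `(p, α, T, g)` that no longer mention the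
keys and are few enough for a union bound. -/
theorem exists_isRelationSystem {b n d u k : ℕ} (hn : 0 < n) (hu : u ≤ 2 ^ (b * n))
    {h : FirstTables b n d} (hk : ¬ IsKUnique k (firstTab u h)) :
    ∃ p ∈ Finset.Icc 1 (n * k), ∃ (α : Fin p → Fin n × BitVec b) (T : Finset (Fin p × Fin d)),
      d * p ≤ 2 * n * T.card ∧ ∃ g : T → Fin (2 * n) → Fin p,
        IsRelationSystem α T g ∧ Satisfies α T g h := by
  classical
  unfold IsKUnique at hk
  push Not at hk
  obtain ⟨X, hX, hXk, hbad⟩ := hk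
  let K : Fin u → Finset (Fin n × BitVec b) := fun x => posChars (chars b n x)
  have hKinj : Function.Injective K := fun x y hxy =>
    Fin.ext (chars_injOn (x.2.trans_le hu) (y.2.trans_le hu) (posChars_injective hxy))
  have hK : ∀ x, (K x).card = n := fun x => card_posChars _
  obtain ⟨rk, hrk, A, hA, hAX, T, hT, hrel⟩ := exists_dense_relations hn hKinj hK (firstTab u h) hX
    (fun x hx j => hbad x hx j)
  -- The characters of `A` are numbered in order of rank, so that a leading character becomes one of
  -- largest index.
  let p := (A.image rk).card
  have hp : p = A.card := Finset.card_image_of_injective A hrk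
  let e := (A.image rk).orderIsoOfFin (rfl : _ = p)
  have hmem : ∀ i : Fin p, ∃ a ∈ A, rk a = e i := fun i => Finset.mem_image.1 (e i).2
  choose α hαA hα using hmem
  have hαinj : Function.Injective α := fun i i' hi => e.injective (Subtype.ext (by
    rw [← hα i, ← hα i', hi]))
  have hαsurj : ∀ a ∈ A, ∃ i, α i = a := fun a ha => by
    refine ⟨e.symm ⟨rk a, Finset.mem_image_of_mem rk ha⟩, hrk ?_⟩
    rw [hα, OrderIso.apply_symm_apply]
  have hαle : ∀ i i', rk (α i) ≤ rk (α i') → i ≤ i' := fun i i' hi => by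
    rw [hα, hα] at hi
    exact e.le_iff_le.1 hi
  let T' : Finset (Fin p × Fin d) := Finset.univ.filter fun t => (α t.1, t.2) ∈ T
  have hT' : T.card ≤ T'.card := by
    refine (Finset.card_le_card (t := T'.image fun t => (α t.1, t.2)) ?_).trans
      Finset.card_image_le
    rintro ⟨a, j⟩ ht
    obtain ⟨i, rfl⟩ := hαsurj a (hrel _ ht).1
    exact Finset.mem_image.2 ⟨(i, j), Finset.mem_filter.2 ⟨Finset.mem_univ _, ht⟩, rfl⟩
  have hg : ∀ t : T', ∃ g : Fin (2 * n) → Fin p, (∃ q, g q = t.1.1) ∧ (∀ q, g q ≤ t.1.1) ∧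
      ∑ q ∈ Finset.univ.image g, XorGroup.ofBits (h (α q).1 (α q).2 t.1.2) = 0 := by
    rintro ⟨⟨i, j⟩, ht⟩
    obtain ⟨-, x, -, y, -, hf, hm, hmax⟩ := hrel _ (Finset.mem_filter.1 ht).2
    let Q : Finset (Fin p) := Finset.univ.filter fun q => α q ∈ symmDiff (K x) (K y)
    have hQimg : Q.image α = symmDiff (K x) (K y) := by
      ext a
      constructor
      · intro ha
        obtain ⟨q, hq, rfl⟩ := Finset.mem_image.1 ha
        exact (Finset.mem_filter.1 hq).2
      · intro ha
        obtain ⟨q, rfl⟩ := hαsurj a (hmax a ha).1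
        exact Finset.mem_image_of_mem _ (Finset.mem_filter.2 ⟨Finset.mem_univ _, ha⟩)
    have hiQ : i ∈ Q := Finset.mem_filter.2 ⟨Finset.mem_univ _, hm⟩
    have hQcard : Q.card ≤ 2 * n := by
      rw [← Finset.card_image_of_injective Q hαinj, hQimg]
      calc (symmDiff (K x) (K y)).card ≤ (K x ∪ K y).card :=
            Finset.card_le_card Finset.symmDiff_subset_union
        _ ≤ (K x).card + (K y).card := Finset.card_union_le _ _
        _ = 2 * n := by rw [hK, hK, two_mul]
    -- Relations have different lengths up to `2n`; listing with repetitions gives them one format.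
    -- Only the image of the list matters.
    have hsurj : ∃ g : Fin (2 * n) → Q, Function.Surjective g := by
      have : Nonempty Q := ⟨⟨i, hiQ⟩⟩
      have : Nonempty (Q ↪ Fin (2 * n)) := Function.Embedding.nonempty_of_card_le (by simpa)
      obtain ⟨f⟩ := this
      exact ⟨Function.invFun f, Function.invFun_surjective f.injective⟩
    obtain ⟨g, hg⟩ := hsurj
    have hgimg : Finset.univ.image (fun q => (g q : Fin p)) = Q := by
      ext q
      constructor
      · intro hq
        obtain ⟨q', -, rfl⟩ := Finset.mem_image.1 hq
        exact (g q').2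
      · intro hq
        obtain ⟨q', hq'⟩ := hg ⟨q, hq⟩
        exact Finset.mem_image.2 ⟨q', Finset.mem_univ _, by rw [hq']⟩
    refine ⟨fun q => g q, ?_, fun q => ?_, ?_⟩
    · obtain ⟨q, hq⟩ := hg ⟨i, hiQ⟩
      exact ⟨q, congrArg Subtype.val hq⟩
    · exact hαle _ _ (hmax _ (Finset.mem_filter.1 (g q).2).2).2
    · rw [hgimg]
      have := Finset.sum_image (s := Q) (g := α) (f := fun a => XorGroup.ofBits (h a.1 a.2 j))
        hαinj.injOn
      rw [← this, hQimg, XorGroup.sum_symmDiff, ← ofBits_firstTab, ← ofBits_firstTab,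
        show firstTab u h y j = firstTab u h x j from hf, XorGroup.add_self]
  choose g hg1 hg2 hg3 using hg
  refine ⟨p, Finset.mem_Icc.2 ⟨?_, ?_⟩, α, T', ?_, g, ⟨hαinj, hg1, hg2⟩, hg3⟩
  · rw [hp]
    exact Finset.card_pos.2 hA
  · rw [hp]
    calc A.card ≤ (X.biUnion K).card := Finset.card_le_card hAX
      _ ≤ X.card * n := Finset.card_biUnion_le_card_mul _ _ _ fun x _ => (hK x).le
      _ ≤ n * k := by rw [mul_comm]; exact Nat.mul_le_mul_left n hXk
  · exact (congrArg (d * ·) hp).trans_le (hT.trans (Nat.mul_le_mul_left _ hT'))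

/-! ### The union bound -/

theorem unifProb_le_sum {Ω κ : Type} [Finite Ω] (E : Set Ω) (s : Finset κ) (F : κ → Set Ω)
    (hE : ∀ ω ∈ E, ∃ i ∈ s, ω ∈ F i) : unifProb E ≤ ∑ i ∈ s, unifProb (F i) := by
  let _ : MeasurableSpace Ω := ⊤
  refine le_trans ?_ (MeasureTheory.measureReal_biUnion_finset_le s F)
  refine MeasureTheory.measureReal_mono (fun ω hω => ?_) (MeasureTheory.measure_ne_top _ _)
  obtain ⟨i, hi, hω⟩ := hE ω hω
  exact Set.mem_biUnion hi hω

theorem unifProb_empty {Ω : Type} : unifProb (∅ : Set Ω) = 0 :=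
  MeasureTheory.measureReal_empty

/-- With `Q = (nk) ^ (2n) ≤ √B`, there are at most `Q ^ |T|` choices of `g`, each of probability at
most `B ^ (-|T|)`, and `|T| ≥ 16p`; this gives `B ^ (-8p)`. The `(nB) ^ p * 2 ^ (pd) ≤ B ^ (2p)`
choices of `α` and `T` leave `B ^ (-6p)`, and `p` takes at most `nk ≤ B` values. -/
theorem unifProb_not_isKUnique_le {b n d u k : ℕ} (hn : 0 < n) (hu : u ≤ 2 ^ (b * n))
    (hd : d = 32 * n) (hk : (n * k) ^ (4 * n) ≤ 2 ^ b) (hnd : n * 2 ^ d ≤ 2 ^ b) :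
    unifProb {h : FirstTables b n d | ¬ IsKUnique k (firstTab u h)} ≤ ((2 ^ b : ℝ) ^ 5)⁻¹ := by
  classical
  set B : ℝ := 2 ^ b with hB
  have hB1 : 1 ≤ B := one_le_pow₀ (by norm_num)
  have hB0 : 0 < B := by positivity
  set Q : ℝ := ((n * k : ℕ) : ℝ) ^ (2 * n) with hQ
  have hQ0 : 0 ≤ Q := by positivity
  have hQ2 : Q ^ 2 ≤ B := by
    rw [hQ, ← pow_mul, show 2 * n * 2 = 4 * n by ring, hB]
    exact_mod_cast hk
  have hQB : Q / B ≤ 1 := by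
    rw [div_le_one hB0]
    nlinarith
  have hQB0 : 0 ≤ Q / B := by positivity
  have hQBsq : (Q / B) ^ 2 ≤ B⁻¹ := by
    rw [div_pow, div_le_iff₀ (by positivity)]
    calc Q ^ 2 ≤ B := hQ2
      _ = B⁻¹ * B ^ 2 := by field_simp
  have hnkB : ((n * k : ℕ) : ℝ) ≤ B := by
    have h1 : n * k ≤ (n * k) ^ (4 * n) := Nat.le_self_pow (by omega) _
    rw [hB]
    exact_mod_cast h1.trans hk
  have hndB : (n : ℝ) * 2 ^ d ≤ B := by
    rw [hB]
    exact_mod_cast hnd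
  have step_g : ∀ p ∈ Finset.Icc 1 (n * k), ∀ αT : (Fin p → Fin n × BitVec b) ×
      Finset (Fin p × Fin d), unifProb {h : FirstTables b n d | d * p ≤ 2 * n * αT.2.card ∧
        ∃ g : αT.2 → Fin (2 * n) → Fin p,
          IsRelationSystem αT.1 αT.2 g ∧ Satisfies αT.1 αT.2 g h} ≤ (B⁻¹ ^ 8) ^ p := by
    rintro p hp ⟨α, T⟩
    by_cases hT : d * p ≤ 2 * n * T.card
    · have hTp : 16 * p ≤ T.card := by
        have : 2 * n * (16 * p) ≤ 2 * n * T.card := by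
          calc 2 * n * (16 * p) = 32 * n * p := by ring
            _ = d * p := by rw [hd]
            _ ≤ _ := hT
        exact Nat.le_of_mul_le_mul_left this (by omega)
      refine (unifProb_le_sum _ Finset.univ (fun g : T → Fin (2 * n) → Fin p =>
        {h | IsRelationSystem α T g ∧ Satisfies α T g h}) ?_).trans ?_
      · rintro h ⟨-, g, hg⟩
        exact ⟨g, Finset.mem_univ _, hg⟩
      have hle : ∀ g : T → Fin (2 * n) → Fin p,
          unifProb {h : FirstTables b n d | IsRelationSystem α T g ∧ Satisfies α T g h} ≤
            (B ^ T.card)⁻¹ := by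
        intro g
        -- Choices of `g` that give no triangular system form an empty event.
        by_cases hg : IsRelationSystem α T g
        · simp only [hg, true_and]
          exact hg.unifProb_eq.le
        · simp only [hg, false_and, Set.ofPred_false, unifProb_empty]
          positivity
      refine (Finset.sum_le_sum fun g _ => hle g).trans ?_
      rw [Finset.sum_const, Finset.card_univ, Fintype.card_fun, Fintype.card_fun, Fintype.card_fin,
        Fintype.card_fin, Fintype.card_coe, nsmul_eq_mul]
      have hpQ : (p : ℝ) ^ (2 * n) ≤ Q := by
        rw [hQ]
        gcongr
        exact_mod_cast (Finset.mem_Icc.1 hp).2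
      calc (((p ^ (2 * n)) ^ T.card : ℕ) : ℝ) * (B ^ T.card)⁻¹
          = ((p : ℝ) ^ (2 * n)) ^ T.card * (B ^ T.card)⁻¹ := by push_cast; rfl
        _ ≤ Q ^ T.card * (B ^ T.card)⁻¹ := by gcongr
        _ = (Q / B) ^ T.card := by rw [div_pow, div_eq_mul_inv]
        _ ≤ (Q / B) ^ (16 * p) := pow_le_pow_of_le_one hQB0 hQB hTp
        _ = (((Q / B) ^ 2) ^ 8) ^ p := by rw [← pow_mul, ← pow_mul]; ring_nf
        _ ≤ (B⁻¹ ^ 8) ^ p := by gcongr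
    · simp only [hT, false_and, Set.ofPred_false, unifProb_empty]
      positivity
  have step_p : ∀ p ∈ Finset.Icc 1 (n * k), unifProb {h : FirstTables b n d |
      ∃ (α : Fin p → Fin n × BitVec b) (T : Finset (Fin p × Fin d)),
        d * p ≤ 2 * n * T.card ∧ ∃ g : T → Fin (2 * n) → Fin p,
          IsRelationSystem α T g ∧ Satisfies α T g h} ≤ B⁻¹ ^ 6 := by
    intro p hp
    refine (unifProb_le_sum _ Finset.univ (fun αT : (Fin p → Fin n × BitVec b) ×
      Finset (Fin p × Fin d) => {h : FirstTables b n d | d * p ≤ 2 * n * αT.2.card ∧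
        ∃ g : αT.2 → Fin (2 * n) → Fin p,
          IsRelationSystem αT.1 αT.2 g ∧ Satisfies αT.1 αT.2 g h}) ?_).trans ?_
    · rintro h ⟨α, T, hT⟩
      exact ⟨(α, T), Finset.mem_univ _, hT⟩
    refine (Finset.sum_le_sum fun αT _ => step_g p hp αT).trans ?_
    have hcard : Fintype.card (BitVec b) = 2 ^ b := by
      rw [← Nat.card_eq_fintype_card, Nat.card_congr XorGroup.ofBits, XorGroup.card]
    rw [Finset.sum_const, Finset.card_univ, Fintype.card_prod, Fintype.card_fun,
      Fintype.card_finset, Fintype.card_prod, Fintype.card_prod, Fintype.card_fin,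
      Fintype.card_fin, Fintype.card_fin, hcard, nsmul_eq_mul]
    have hp1 : p ≠ 0 := by have := (Finset.mem_Icc.1 hp).1; omega
    calc (((n * 2 ^ b) ^ p * 2 ^ (p * d) : ℕ) : ℝ) * (B⁻¹ ^ 8) ^ p
        = ((n * 2 ^ d) * B * B⁻¹ ^ 8) ^ p := by
          push_cast
          rw [← hB, mul_pow, mul_pow, mul_pow, mul_pow, ← pow_mul 2 d p, mul_comm d p]
          ring
      _ ≤ (B * B * B⁻¹ ^ 8) ^ p := by gcongr
      _ = (B⁻¹ ^ 6) ^ p := by congr 1; field_simp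
      _ ≤ B⁻¹ ^ 6 := pow_le_of_le_one (by positivity)
          (pow_le_one₀ (by positivity) (inv_le_one_of_one_le₀ hB1)) hp1
  refine (unifProb_le_sum _ (Finset.Icc 1 (n * k)) (fun p => {h : FirstTables b n d |
      ∃ (α : Fin p → Fin n × BitVec b) (T : Finset (Fin p × Fin d)),
        d * p ≤ 2 * n * T.card ∧ ∃ g : T → Fin (2 * n) → Fin p,
          IsRelationSystem α T g ∧ Satisfies α T g h})
    (fun h hh => exists_isRelationSystem hn hu hh)).trans ?_
  refine (Finset.sum_le_sum step_p).trans ?_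
  rw [Finset.sum_const, Nat.card_Icc, Nat.add_sub_cancel, nsmul_eq_mul]
  calc ((n * k : ℕ) : ℝ) * B⁻¹ ^ 6 ≤ B * B⁻¹ ^ 6 := by gcongr
    _ = (B ^ 5)⁻¹ := by field_simp

theorem unifProb_not_isUniversal_le {b n d u k : ℕ} (hn : 0 < n) (hu : u ≤ 2 ^ (b * n))
    (hk1 : 1 ≤ k) (hd : d = 32 * n) (hk : (n * k) ^ (4 * n) ≤ 2 ^ b) (hnd : n * 2 ^ d ≤ 2 ^ b) :
    unifProb {h : FirstTables b n d | ¬ IsUniversal u k h} ≤ ((2 ^ b : ℝ) ^ 5)⁻¹ := by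
  convert unifProb_not_isKUnique_le hn hu hd hk hnd using 5 with h
  exact ⟨fun hh => hh.1, fun hh => ⟨hh, fun ρ => hh.isKIndependent_doubleTab hk1 ρ⟩⟩

/-! ### Exclusive-or sums and packed words -/

theorem setWidth_xorSum {n m w : ℕ} (f : Fin n → BitVec m) :
    (xorSum f).setWidth w = xorSum fun i => (f i).setWidth w := by
  induction n with
  | zero => simp [xorSum]
  | succ n ih => rw [xorSum_succ, xorSum_succ, BitVec.setWidth_xor, ih]

theorem xorSum_prod {p q m : ℕ} (f : Fin (p * q) → BitVec m) :
    (xorSum fun g : Fin p => xorSum fun j : Fin q => f (finProdFinEquiv (g, j))) = xorSum f := by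
  apply XorGroup.ofBits.injective
  simp_rw [ofBits_xorSum]
  rw [← Fintype.sum_prod_type' (f := fun g j => XorGroup.ofBits (f (finProdFinEquiv (g, j))))]
  exact Equiv.sum_comp finProdFinEquiv fun i => XorGroup.ofBits (f i)

/-- The characters `v 0, …, v (c - 1)` of `b` bits, side by side in a word of `w` bits. -/
def pack {b c : ℕ} (w : ℕ) (v : Fin c → BitVec b) : BitVec w :=
  BitVec.ofFnLE fun t : Fin w =>
    if h : (t : ℕ) / b < c then (v ⟨t / b, h⟩).getLsbD (t % b) else false

theorem pack_xor {b c w : ℕ} (v v' : Fin c → BitVec b) :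
    pack w (fun j => v j ^^^ v' j) = pack w v ^^^ pack w v' := by
  ext t ht
  simp only [pack, BitVec.getElem_xor, BitVec.getElem_ofFnLE]
  split <;> simp

/-- Xor acts bit by bit, so one word operation performs `c` simple tabulations in parallel. -/
theorem pack_xorSum {n b c w : ℕ} (v : Fin n → Fin c → BitVec b) :
    (xorSum fun i => pack w (v i)) = pack w fun j => xorSum fun i => v i j := by
  induction n with
  | zero =>
    ext t ht
    simp [xorSum, pack, BitVec.getElem_ofFnLE]
  | succ n ih =>
    simp_rw [xorSum_succ]
    rw [ih, pack_xor]

theorem ofNat_pack_div {b c w : ℕ} (hw : b * c ≤ w) (v : Fin c → BitVec b) (j : Fin c) :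
    BitVec.ofNat b ((pack w v).toNat / 2 ^ (b * (j : ℕ))) = v j := by
  ext t ht
  have hlt : b * (j : ℕ) + t < w := by
    have : b * ((j : ℕ) + 1) ≤ b * c := Nat.mul_le_mul_left b j.2
    rw [mul_add] at this
    omega
  have hb : 0 < b := by omega
  have hdiv : (b * (j : ℕ) + t) / b = j := by
    rw [Nat.mul_add_div hb, Nat.div_eq_of_lt ht, add_zero]
  have hmod : (b * (j : ℕ) + t) % b = t := by
    rw [Nat.mul_add_mod, Nat.mod_eq_of_lt ht]
  rw [← BitVec.getLsbD_eq_getElem, ← BitVec.getLsbD_eq_getElem, BitVec.getLsbD_ofNat,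
    ← Nat.shiftRight_eq_div_pow, Nat.testBit_shiftRight, BitVec.testBit_toNat,
    BitVec.getLsbD_eq_getElem hlt]
  simp [pack, BitVec.getElem_ofFnLE, hdiv, hmod, ht]

/-! ### The program

Register `0` holds the key, registers `1` to `6` the mask `2 ^ b - 1`, the character length `b`, the
table size `2 ^ b`, the total sizes of a block of first and of second tables, and the end of the
memory. Register `7` points to the current table, register `8` to the end of the current block. -/

/-- One table look-up with the lowest character of register `y`, added to register `a`. -/
def lookupStep (y a : ℕ) : Cmd :=
  .seq (.op .and 9 y 1) <| .seq (.op .add 9 9 7) <| .seq (.load 9 9) <| .seq (.op .xor a a 9) <|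
    .seq (.op .shr y y 2) (.op .add 7 7 3)

/-- Look-ups with the consecutive characters of register `y`, in the tables of the current block. -/
def lookupLoop (y a : ℕ) : Cmd := .loop 7 8 (lookupStep y a)

/-- Computes one word of packed intermediate characters and looks all of them up. -/
def groupStep : Cmd :=
  .seq (.move 10 0) <| .seq (.const 11 0) <| .seq (.op .add 8 7 4) <| .seq (lookupLoop 10 11) <|
    .seq (.op .add 8 7 5) (lookupLoop 11 12)

/-- Loads memory word `i` into register `dst`. -/
def loadParam (dst i : ℕ) : Cmd := .seq (.const 7 i) (.load dst 7)

/-- Evaluates double tabulation. -/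
def evalProgram : Cmd :=
  .seq (loadParam 1 0) <| .seq (loadParam 2 1) <| .seq (loadParam 3 2) <| .seq (loadParam 4 3) <|
    .seq (loadParam 5 4) <| .seq (loadParam 6 5) <| .seq (.const 7 6) <|
      .seq (.loop 7 6 groupStep) (.move 0 12)

/-- The registers hold the parameters of the memory layout. -/
structure HasParams {w S : ℕ} (b m₁ m₂ : ℕ) (s : State w S) : Prop where
  mask : (s.reg 1).toNat = 2 ^ b - 1
  shift : (s.reg 2).toNat = b
  size : (s.reg 3).toNat = 2 ^ b
  first : (s.reg 4).toNat = m₁ * 2 ^ b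
  second : (s.reg 5).toNat = m₂ * 2 ^ b
  memEnd : (s.reg 6).toNat = S

theorem HasParams.congr {w S b m₁ m₂ : ℕ} {s s' : State w S} (hs : HasParams b m₁ m₂ s)
    (h : ∀ i < 7, s'.reg i = s.reg i) : HasParams b m₁ m₂ s' where
  mask := by rw [h 1 (by norm_num), hs.mask]
  shift := by rw [h 2 (by norm_num), hs.shift]
  size := by rw [h 3 (by norm_num), hs.size]
  first := by rw [h 4 (by norm_num), hs.first]
  second := by rw [h 5 (by norm_num), hs.second]
  memEnd := by rw [h 6 (by norm_num), hs.memEnd]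

theorem Exec.of_steps_eq {w S t t' : ℕ} {P : Cmd} {s s' : State w S} (h : Exec P s t s')
    (ht : t = t') : Exec P s t' s' := ht ▸ h

/-- The bounds on `y` and `a` keep them clear of the key, the parameters, the pointers and the
scratch register `9`. As `S < 2 ^ w`, address arithmetic does not wrap around. -/
theorem exec_lookupStep {w S b m₁ m₂ y a q : ℕ} (hy : 10 ≤ y) (ha : 10 ≤ a) (hya : y ≠ a)
    (W : ℕ → BitVec w) {s : State w S} (hs : HasParams b m₁ m₂ s) (hS : S < 2 ^ w)
    (hmem : ∀ i, s.mem i = W i) (hq : (s.reg 7).toNat = q) (hqS : q + 2 ^ b ≤ S) :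
    ∃ s' : State w S, Exec (lookupStep y a) s 6 s' ∧ s'.mem = s.mem ∧
      (s'.reg 7).toNat = q + 2 ^ b ∧ (s'.reg y).toNat = (s.reg y).toNat / 2 ^ b ∧
      s'.reg a = s.reg a ^^^ W (q + (s.reg y).toNat % 2 ^ b) ∧
      ∀ i, i ≠ 7 → i ≠ 9 → i ≠ y → i ≠ a → s'.reg i = s.reg i := by
  have hmod : (s.reg y).toNat % 2 ^ b < 2 ^ b := Nat.mod_lt _ (by positivity)
  have haddr : ((s.reg y &&& s.reg 1) + s.reg 7).toNat = q + (s.reg y).toNat % 2 ^ b := by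
    rw [BitVec.toNat_add, BitVec.toNat_and, hs.mask, Nat.and_two_pow_sub_one_eq_mod, hq,
      Nat.mod_eq_of_lt (by omega), add_comm]
  have hy3 : y ≠ 3 := by omega
  have hy7 : y ≠ 7 := by omega
  have hy9 : y ≠ 9 := by omega
  have ha2 : a ≠ 2 := by omega
  have ha3 : a ≠ 3 := by omega
  have ha7 : a ≠ 7 := by omega
  have ha9 : a ≠ 9 := by omega
  refine ⟨_, .seq (.op s .and 9 y 1) (.seq (.op _ .add 9 9 7) (.seq (.load _ 9 9 ?_)
    (.seq (.op _ .xor a a 9) (.seq (.op _ .shr y y 2) (.op _ .add 7 7 3))))), ?_⟩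
  · simp [-BitVec.toNat_add, State.setReg, BinOp.eval, haddr]
    omega
  · have hmem' : ∀ h, s.mem ⟨((s.reg y &&& s.reg 1) + s.reg 7).toNat, h⟩ =
        W (q + (s.reg y).toNat % 2 ^ b) := fun h => by
      rw [hmem]
      exact congrArg W haddr
    refine ⟨rfl, ?_, ?_, ?_, ?_⟩
    · simp [State.setReg, BinOp.eval, Function.update_apply, hy7.symm, ha7.symm, hy3.symm,
        ha3.symm, hs.size, hq]
      exact Nat.mod_eq_of_lt (by omega)
    · simp [State.setReg, BinOp.eval, Function.update_apply, hy7, hy9, hya, ha2.symm,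
        hs.shift, Nat.shiftRight_eq_div_pow]
    · simp [-BitVec.toNat_add, State.setReg, BinOp.eval, Function.update_apply, ha7, ha9,
        hya.symm, hmem']
    · intro i h1 h2 h3 h4
      simp [State.setReg, Function.update_apply, h1, h2, h3, h4]

theorem exec_lookupLoop {w S b m₁ m₂ y a : ℕ} (hy : 10 ≤ y) (ha : 10 ≤ a) (hya : y ≠ a)
    (W : ℕ → BitVec w) (hS : S < 2 ^ w) (m : ℕ) : ∀ (q : ℕ) {s : State w S},
    HasParams b m₁ m₂ s → (∀ i, s.mem i = W i) → (s.reg 7).toNat = q →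
    (s.reg 8).toNat = q + m * 2 ^ b → q + m * 2 ^ b ≤ S →
    ∃ s' : State w S, Exec (lookupLoop y a) s (7 * m + 1) s' ∧ s'.mem = s.mem ∧
      (s'.reg 7).toNat = q + m * 2 ^ b ∧
      s'.reg a = s.reg a ^^^ xorSum (fun i : Fin m =>
        W (q + i * 2 ^ b + (s.reg y).toNat / 2 ^ (b * (i : ℕ)) % 2 ^ b)) ∧
      ∀ i, i ≠ 7 → i ≠ 9 → i ≠ y → i ≠ a → s'.reg i = s.reg i := by
  induction m with
  | zero =>
    intro q s hs hmem h7 h8 hqS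
    refine ⟨s, .loop_false (by omega), rfl, by omega, ?_, fun _ _ _ _ _ => rfl⟩
    simp [xorSum]
  | succ m ih =>
    intro q s hs hmem h7 h8 hqS
    have hpos : 0 < 2 ^ b := by positivity
    rw [add_mul, one_mul] at h8 hqS
    obtain ⟨s₁, hex, hm, h71, hy1, ha1, hrest⟩ :=
      exec_lookupStep hy ha hya W hs hS hmem h7 (by omega)
    have h81 : s₁.reg 8 = s.reg 8 :=
      hrest 8 (by norm_num) (by norm_num) (by omega) (by omega)
    obtain ⟨s₂, hex2, hm2, h72, ha2, hrest2⟩ := ih (q + 2 ^ b) (s := s₁)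
      (hs.congr fun i hi => hrest i (by omega) (by omega) (by omega) (by omega))
      (fun i => by rw [hm, hmem]) h71 (by rw [h81]; omega) (by omega)
    refine ⟨s₂, ?_, hm2.trans hm, by rw [h72]; ring, ?_, fun i h1 h2 h3 h4 => by
      rw [hrest2 i h1 h2 h3 h4, hrest i h1 h2 h3 h4]⟩
    · have := Exec.loop_true (a := 7) (b := 8) (by omega) hex hex2
      exact this.of_steps_eq (by ring)
    · rw [ha2, ha1, hy1, xorSum_succ, BitVec.xor_assoc]
      congr 2
      · simp
      · congr 1
        funext i
        congr 1
        -- One step has already shifted out a character, so the `i`-th remaining one is character `i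
        -- + 1` of the original word.
        rw [Nat.div_div_eq_div_mul, ← pow_add, Fin.val_succ]
        ring_nf

/-- The word of packed intermediate characters computed from the first tables at `q`. -/
def groupWord {w : ℕ} (W : ℕ → BitVec w) (b m₁ x q : ℕ) : BitVec w :=
  xorSum fun i : Fin m₁ => W (q + i * 2 ^ b + x / 2 ^ (b * (i : ℕ)) % 2 ^ b)

/-- The contribution to the hash value of the group of tables at `q`. -/
def groupValue {w : ℕ} (W : ℕ → BitVec w) (b m₁ m₂ x q : ℕ) : BitVec w :=
  xorSum fun j : Fin m₂ => W (q + m₁ * 2 ^ b + j * 2 ^ b +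
    (groupWord W b m₁ x q).toNat / 2 ^ (b * (j : ℕ)) % 2 ^ b)

theorem exec_groupStep {w S b m₁ m₂ q : ℕ} (W : ℕ → BitVec w) {s : State w S}
    (hs : HasParams b m₁ m₂ s) (hS : S < 2 ^ w) (hmem : ∀ i, s.mem i = W i)
    (hq : (s.reg 7).toNat = q) (hqS : q + (m₁ + m₂) * 2 ^ b ≤ S) :
    ∃ s' : State w S, Exec groupStep s (7 * (m₁ + m₂) + 6) s' ∧ s'.mem = s.mem ∧
      (s'.reg 7).toNat = q + (m₁ + m₂) * 2 ^ b ∧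
      s'.reg 12 = s.reg 12 ^^^ groupValue W b m₁ m₂ (s.reg 0).toNat q ∧
      ∀ i < 7, s'.reg i = s.reg i := by
  rw [add_mul] at hqS
  let s₁ : State w S := ((s.setReg 10 (s.reg 0)).setReg 11 (BitVec.ofNat w 0)).setReg 8
    (s.reg 7 + s.reg 4)
  have h1 : ∀ i < 7, s₁.reg i = s.reg i := fun i hi => by
    simp [s₁, State.setReg, show i ≠ 8 by omega, show i ≠ 11 by omega,
      show i ≠ 10 by omega]
  have h17 : s₁.reg 7 = s.reg 7 := by simp [s₁, State.setReg]
  have h18 : (s₁.reg 8).toNat = q + m₁ * 2 ^ b := by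
    have : s₁.reg 8 = s.reg 7 + s.reg 4 := by simp [s₁, State.setReg]
    rw [this, BitVec.toNat_add, hq, hs.first, Nat.mod_eq_of_lt (by omega)]
  have h110 : s₁.reg 10 = s.reg 0 := by simp [s₁, State.setReg]
  have h111 : s₁.reg 11 = 0 := by simp [s₁, State.setReg]
  have h112 : s₁.reg 12 = s.reg 12 := by simp [s₁, State.setReg]
  obtain ⟨s₂, hex2, hm2, h72, ha2, hrest2⟩ := exec_lookupLoop (y := 10) (a := 11) (by norm_num)
    (by norm_num) (by norm_num) W hS m₁ q (s := s₁) (hs.congr h1) hmem (by rw [h17, hq]) h18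
    (by omega)
  have hw2 : s₂.reg 11 = groupWord W b m₁ (s.reg 0).toNat q := by
    rw [ha2, h111, h110]
    exact BitVec.zero_xor
  have h2 : ∀ i < 7, s₂.reg i = s.reg i := fun i hi => by
    rw [hrest2 i (by omega) (by omega) (by omega) (by omega), h1 i hi]
  let s₃ : State w S := s₂.setReg 8 (s₂.reg 7 + s₂.reg 5)
  have h3 : ∀ i ≠ 8, s₃.reg i = s₂.reg i := fun i hi => by
    simp [s₃, State.setReg, hi]
  have h38 : (s₃.reg 8).toNat = q + m₁ * 2 ^ b + m₂ * 2 ^ b := by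
    have : s₃.reg 8 = s₂.reg 7 + s₂.reg 5 := by simp [s₃, State.setReg]
    rw [this, BitVec.toNat_add, h72, h2 5 (by norm_num), hs.second, Nat.mod_eq_of_lt (by omega)]
  obtain ⟨s₄, hex4, hm4, h74, ha4, hrest4⟩ := exec_lookupLoop (y := 11) (a := 12) (by norm_num)
    (by norm_num) (by norm_num) W hS m₂ (q + m₁ * 2 ^ b) (s := s₃)
    (hs.congr fun i hi => by rw [h3 i (by omega), h2 i hi])
    (fun i => by rw [← hmem i]; exact congrFun hm2 i)
    (by rw [h3 7 (by norm_num), h72]) h38 (by omega)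
  refine ⟨s₄, ?_, hm4.trans hm2, by rw [h74]; ring, ?_, fun i hi => ?_⟩
  · have e3 : Exec (.op .add 8 7 4)
        ((s.setReg 10 (s.reg 0)).setReg 11 (BitVec.ofNat w 0)) 1 s₁ := by
      have := Exec.op ((s.setReg 10 (s.reg 0)).setReg 11 (BitVec.ofNat w 0)) .add 8 7 4
      simpa [s₁, State.setReg, BinOp.eval] using this
    have := Exec.seq (Exec.move s 10 0) (Exec.seq (Exec.const _ 11 0) (Exec.seq e3
      (Exec.seq hex2 (Exec.seq (Exec.op s₂ .add 8 7 5) hex4))))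
    exact this.of_steps_eq (by ring)
  · rw [ha4, h3 12 (by norm_num), h3 11 (by norm_num), hw2,
      hrest2 12 (by norm_num) (by norm_num) (by norm_num) (by norm_num), h112]
    rfl
  · rw [hrest4 i (by omega) (by omega) (by omega) (by omega), h3 i (by omega), h2 i hi]

theorem exec_groupLoop {w S b m₁ m₂ : ℕ} (W : ℕ → BitVec w) (hS : S < 2 ^ w) (hm : 0 < m₁ + m₂)
    (G : ℕ) : ∀ (q : ℕ) {s : State w S}, HasParams b m₁ m₂ s → (∀ i, s.mem i = W i) →
    (s.reg 7).toNat = q → q + G * ((m₁ + m₂) * 2 ^ b) = S →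
    ∃ s' : State w S, Exec (.loop 7 6 groupStep) s (G * (7 * (m₁ + m₂) + 7) + 1) s' ∧
      s'.reg 12 = s.reg 12 ^^^ xorSum (fun g : Fin G =>
        groupValue W b m₁ m₂ (s.reg 0).toNat (q + g * ((m₁ + m₂) * 2 ^ b))) := by
  induction G with
  | zero =>
    intro q s hs hmem h7 hqS
    refine ⟨s, ?_, by simp [xorSum]⟩
    rw [zero_mul]
    exact .loop_false (by rw [hs.memEnd]; omega)
  | succ G ih =>
    intro q s hs hmem h7 hqS
    -- A group occupies space, so the table pointer is still strictly below the end of memory and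
    -- the loop test succeeds.
    have hpos : 0 < (m₁ + m₂) * 2 ^ b := by positivity
    rw [add_mul, one_mul] at hqS
    obtain ⟨s₁, hex, hm1, h71, ha1, hrest⟩ := exec_groupStep W hs hS hmem h7 (by omega)
    obtain ⟨s₂, hex2, ha2⟩ := ih (q + (m₁ + m₂) * 2 ^ b) (hs.congr hrest)
      (fun i => by rw [hm1, hmem]) h71 (by omega)
    refine ⟨s₂, ?_, ?_⟩
    · have := Exec.loop_true (a := 7) (b := 6) (by rw [hs.memEnd]; omega) hex hex2
      exact this.of_steps_eq (by ring)
    · rw [ha2, ha1, hrest 0 (by norm_num), xorSum_succ, BitVec.xor_assoc]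
      congr 2
      · simp
      · congr 1
        funext i
        congr 1
        rw [Fin.val_succ]
        ring

theorem exec_loadParam {w S : ℕ} (W : ℕ → BitVec w) (s : State w S) (hmem : ∀ i, s.mem i = W i)
    (hS : S < 2 ^ w) (dst i : ℕ) (hi : i < S) :
    Exec (loadParam dst i) s 2 ((s.setReg 7 (BitVec.ofNat w i)).setReg dst (W i)) := by
  have h7 : ((s.setReg 7 (BitVec.ofNat w i)).reg 7).toNat = i := by
    simpa [State.setReg] using Nat.mod_eq_of_lt (hi.trans hS)
  have := Exec.load (s.setReg 7 (BitVec.ofNat w i)) dst 7 (by rw [h7]; exact hi)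
  have e : (s.setReg 7 (BitVec.ofNat w i)).mem ⟨((s.setReg 7 (BitVec.ofNat w i)).reg 7).toNat,
      by rw [h7]; exact hi⟩ = W i := (hmem _).trans (congrArg W h7)
  rw [e] at this
  exact .seq (.const s 7 i) this

theorem exec_evalProgram {w S b m₁ m₂ G x : ℕ} (W : ℕ → BitVec w) (hS : S < 2 ^ w)
    (hm : 0 < m₁ + m₂) (hGS : 6 + G * ((m₁ + m₂) * 2 ^ b) = S) (hx : x < 2 ^ w)
    (h0 : (W 0).toNat = 2 ^ b - 1) (h1 : (W 1).toNat = b) (h2 : (W 2).toNat = 2 ^ b)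
    (h3 : (W 3).toNat = m₁ * 2 ^ b) (h4 : (W 4).toNat = m₂ * 2 ^ b) (h5 : (W 5).toNat = S) :
    ∃ s : State w S,
      Exec evalProgram (queryState (fun i : Fin S => W i) x) (G * (7 * (m₁ + m₂) + 7) + 15) s ∧
      s.reg 0 = xorSum fun g : Fin G =>
        groupValue W b m₁ m₂ x (6 + g * ((m₁ + m₂) * 2 ^ b)) := by
  have h6S : 6 ≤ S := by omega
  have hmem : ∀ i, (queryState (fun i : Fin S => W i) x).mem i = W i := fun i => rfl
  let ld : State w S → ℕ → ℕ → State w S := fun s dst i =>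
    (s.setReg 7 (BitVec.ofNat w i)).setReg dst (W i)
  let s₀ : State w S := queryState (fun i : Fin S => W i) x
  let s₁ := ld s₀ 1 0
  let s₂ := ld s₁ 2 1
  let s₃ := ld s₂ 3 2
  let s₄ := ld s₃ 4 3
  let s₅ := ld s₄ 5 4
  let s₆ := ld s₅ 6 5
  let s₇ := s₆.setReg 7 (BitVec.ofNat w 6)
  have hr1 : s₇.reg 1 = W 0 := by simp [s₇, s₆, s₅, s₄, s₃, s₂, s₁, ld, State.setReg]
  have hr2 : s₇.reg 2 = W 1 := by simp [s₇, s₆, s₅, s₄, s₃, s₂, ld, State.setReg]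
  have hr3 : s₇.reg 3 = W 2 := by simp [s₇, s₆, s₅, s₄, s₃, ld, State.setReg]
  have hr4 : s₇.reg 4 = W 3 := by simp [s₇, s₆, s₅, s₄, ld, State.setReg]
  have hr5 : s₇.reg 5 = W 4 := by simp [s₇, s₆, s₅, ld, State.setReg]
  have hr6 : s₇.reg 6 = W 5 := by simp [s₇, s₆, ld, State.setReg]
  have hr7 : (s₇.reg 7).toNat = 6 := by
    simpa [s₇, State.setReg] using Nat.mod_eq_of_lt (h6S.trans_lt hS)
  have hr0 : (s₇.reg 0).toNat = x := by
    simpa [s₇, s₆, s₅, s₄, s₃, s₂, s₁, s₀, ld, State.setReg, queryState] using Nat.mod_eq_of_lt hx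
  have hr12 : s₇.reg 12 = 0 := by
    simp [s₇, s₆, s₅, s₄, s₃, s₂, s₁, s₀, ld, State.setReg, queryState]
  have hp : HasParams b m₁ m₂ s₇ :=
    ⟨by rw [hr1, h0], by rw [hr2, h1], by rw [hr3, h2], by rw [hr4, h3], by rw [hr5, h4],
      by rw [hr6, h5]⟩
  obtain ⟨s, hex, hs12⟩ := exec_groupLoop W hS hm G 6 hp (fun i => rfl) hr7 hGS
  refine ⟨s.setReg 0 (s.reg 12), ?_, ?_⟩
  · have hload : ∀ (s : State w S) (dst i : ℕ), (∀ i, s.mem i = W i) → i < 6 →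
        Exec (loadParam dst i) s 2 (ld s dst i) := fun s dst i hmem hi =>
      exec_loadParam W s hmem hS dst i (by omega)
    have := Exec.seq (hload s₀ 1 0 hmem (by norm_num)) <|
      Exec.seq (hload s₁ 2 1 hmem (by norm_num)) <| Exec.seq (hload s₂ 3 2 hmem (by norm_num)) <|
      Exec.seq (hload s₃ 4 3 hmem (by norm_num)) <| Exec.seq (hload s₄ 5 4 hmem (by norm_num)) <|
      Exec.seq (hload s₅ 6 5 hmem (by norm_num)) <| Exec.seq (Exec.const s₆ 7 6) <|
      Exec.seq hex (Exec.move s 0 12)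
    exact this.of_steps_eq (by ring)
  · have : (s.setReg 0 (s.reg 12)).reg 0 = s.reg 12 := by simp [State.setReg]
    rw [this, hs12, hr12, hr0]
    exact BitVec.zero_xor

/-! ### The memory layout -/

section Layout

variable {b c d ρ : ℕ} (w : ℕ) (h : FirstTables b (2 * c) (d * c)) (r : SecondTables b (d * c) ρ)

/-- The entry for the character `a` of the `i`-th table of group `g`: first the `2 * c` tables of
the first function, with `c` packed characters of group `g`, then `c` tables of the second
function. -/
def tableWord (g : Fin d) (i : ℕ) (a : BitVec b) : BitVec w :=
  if hi : i < 2 * c then pack w fun j : Fin c => h ⟨i, hi⟩ a (finProdFinEquiv (g, j))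
  else if hj : i - 2 * c < c then (r (finProdFinEquiv (g, ⟨i - 2 * c, hj⟩)) a).setWidth w
  else 0

/-- The size of the memory. -/
def memSize (b c d : ℕ) : ℕ := 6 + d * ((2 * c + c) * 2 ^ b)

/-- The parameters at the beginning of the memory. -/
def paramWord (b c d : ℕ) : ℕ → ℕ
  | 0 => 2 ^ b - 1
  | 1 => b
  | 2 => 2 ^ b
  | 3 => 2 * c * 2 ^ b
  | 4 => c * 2 ^ b
  | _ => memSize b c d

/-- The contents of the memory. -/
def memWord (e : ℕ) : BitVec w :=
  if e < 6 then BitVec.ofNat w (paramWord b c d e)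
  else if hg : (e - 6) / 2 ^ b / (2 * c + c) < d then
    tableWord w h r ⟨_, hg⟩ ((e - 6) / 2 ^ b % (2 * c + c)) (BitVec.ofNat b (e - 6))
  else 0

/-- Offsets are mixed-radix numbers with digits group, table and character; tables lie in the order
in which the program visits them, so its pointer only moves forward. -/
theorem memWord_table (g : Fin d) {i : ℕ} (hi : i < 2 * c + c) (y : ℕ) :
    memWord w h r (6 + g * ((2 * c + c) * 2 ^ b) + i * 2 ^ b + y % 2 ^ b) =
      tableWord w h r g i (BitVec.ofNat b y) := by
  have hB : 0 < 2 ^ b := by positivity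
  have hy : y % 2 ^ b < 2 ^ b := Nat.mod_lt _ hB
  have he : 6 + g * ((2 * c + c) * 2 ^ b) + i * 2 ^ b + y % 2 ^ b - 6 =
      2 ^ b * ((2 * c + c) * g + i) + y % 2 ^ b := by
    have : 6 + g * ((2 * c + c) * 2 ^ b) + i * 2 ^ b + y % 2 ^ b =
      6 + (2 ^ b * ((2 * c + c) * g + i) + y % 2 ^ b) := by ring
    rw [this, Nat.add_sub_cancel_left]
  have hdiv : (2 ^ b * ((2 * c + c) * g + i) + y % 2 ^ b) / 2 ^ b = (2 * c + c) * g + i := by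
    rw [Nat.mul_add_div hB, Nat.div_eq_of_lt hy, add_zero]
  have hdiv' : ((2 * c + c) * (g : ℕ) + i) / (2 * c + c) = g := by
    rw [Nat.mul_add_div (by omega), Nat.div_eq_of_lt hi, add_zero]
  have hmod : ((2 * c + c) * (g : ℕ) + i) % (2 * c + c) = i := by
    rw [Nat.mul_add_mod, Nat.mod_eq_of_lt hi]
  have hchar : BitVec.ofNat b (2 ^ b * ((2 * c + c) * g + i) + y % 2 ^ b) = BitVec.ofNat b y := by
    apply BitVec.eq_of_toNat_eq
    simp
  rw [memWord, if_neg (by omega)]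
  simp only [he, hdiv, hdiv', hmod, hchar, Fin.is_lt, dif_pos]

theorem groupWord_memWord (g : Fin d) (x : ℕ) :
    groupWord (memWord w h r) b (2 * c) x (6 + g * ((2 * c + c) * 2 ^ b)) =
      pack w fun j : Fin c => simpleTabVec h (chars b (2 * c) x) (finProdFinEquiv (g, j)) := by
  rw [groupWord]
  have : ∀ i : Fin (2 * c), memWord w h r (6 + g * ((2 * c + c) * 2 ^ b) + i * 2 ^ b +
      x / 2 ^ (b * (i : ℕ)) % 2 ^ b) =
        pack w fun j : Fin c => h i (chars b (2 * c) x i) (finProdFinEquiv (g, j)) := by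
    intro i
    rw [memWord_table w h r g (by omega), tableWord, dif_pos i.2]
    rfl
  simp_rw [this]
  exact pack_xorSum _

theorem groupValue_memWord (hw : b * c ≤ w) (g : Fin d) (x : ℕ) :
    groupValue (memWord w h r) b (2 * c) c x (6 + g * ((2 * c + c) * 2 ^ b)) =
      xorSum fun j : Fin c => (r (finProdFinEquiv (g, j))
        (simpleTabVec h (chars b (2 * c) x) (finProdFinEquiv (g, j)))).setWidth w := by
  rw [groupValue, groupWord_memWord]
  congr 1
  funext j
  rw [add_assoc (6 + g * ((2 * c + c) * 2 ^ b)), ← add_mul,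
    memWord_table w h r g (by omega), ofNat_pack_div hw, tableWord, dif_neg (by omega)]
  simp

/-- Here `d` counts groups. Each group costs `3c` look-ups of `7` steps and an overhead of `7`, at
most `28c` steps; the remaining `15` are at most `15c`. -/
theorem evaluates_doubleTab {u : ℕ} (hc : 1 ≤ c) (hd : 1 ≤ d) (hw : b * c ≤ w) (hu : u ≤ 2 ^ w)
    (hS : memSize b c d < 2 ^ w) :
    Evaluates evalProgram w (memSize b c d) ((28 * d + 15) * c) (doubleTab u h r) := by
  refine ⟨fun i => memWord w h r i, fun x => ?_⟩
  have hparam : ∀ e < 6, paramWord b c d e < 2 ^ w →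
      (memWord w h r e).toNat = paramWord b c d e := by
    intro e he hlt
    rw [memWord, if_pos he, BitVec.toNat_ofNat, Nat.mod_eq_of_lt hlt]
  have hle : (2 * c + c) * 2 ^ b < 2 ^ w := by
    refine lt_of_le_of_lt ?_ hS
    rw [memSize]
    exact (Nat.le_mul_of_pos_left _ hd).trans (Nat.le_add_left _ _)
  rw [add_mul] at hle
  have hcb : 2 ^ b ≤ c * 2 ^ b := Nat.le_mul_of_pos_left _ hc
  have hb : b < 2 ^ b := Nat.lt_two_pow_self
  obtain ⟨s, hex, hs⟩ := exec_evalProgram (b := b) (m₁ := 2 * c) (m₂ := c) (G := d)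
    (memWord w h r) hS (by omega) rfl (x.2.trans_le hu)
    (hparam 0 (by norm_num) (by simp only [paramWord]; omega))
    (hparam 1 (by norm_num) (by simp only [paramWord]; omega))
    (hparam 2 (by norm_num) (by simp only [paramWord]; omega))
    (hparam 3 (by norm_num) (by simp only [paramWord]; omega))
    (hparam 4 (by norm_num) (by simp only [paramWord]; omega))
    (hparam 5 (by norm_num) hS)
  refine ⟨_, s, ?_, hex, ?_⟩
  · calc d * (7 * (2 * c + c) + 7) + 15 ≤ d * (7 * (2 * c + c) + 7 * c) + 15 * c := by
          gcongr <;> omega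
      _ = (28 * d + 15) * c := by ring
  · rw [hs]
    simp_rw [groupValue_memWord w h r hw]
    rw [xorSum_prod (fun j => (r j (simpleTabVec h (chars b (2 * c) x) j)).setWidth w),
      ← setWidth_xorSum]
    rfl

end Layout

/-! ### Asymptotics -/

/-- Taking logarithms, the hypothesis reads `c² log c = o(log u)`. For `c ≥ 4`, `log (4c) ≤ 2 log
c`; for `c ≤ 4` the left side is bounded while `log u` tends to infinity. -/
theorem eventually_mul_log_le {ι : Type} {l : Filter ι} {u c : ι → ℕ} (hu : Tendsto u l atTop)
    (hc : ∀ i, 1 ≤ c i)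
    (hcu : IsPowLittleOOne l (fun i => (c i : ℝ) ^ (c i ^ 2)) (fun i => (u i : ℝ))) (K : ℝ) :
    ∀ᶠ i in l, K * ((c i : ℝ) ^ 2 * Real.log (4 * c i)) ≤ Real.log (u i) := by
  wlog hK : 0 < K generalizing K
  · filter_upwards [this 1 one_pos] with i hi
    have h1 : (1 : ℝ) ≤ c i := by exact_mod_cast hc i
    have : 0 ≤ (c i : ℝ) ^ 2 * Real.log (4 * c i) :=
      mul_nonneg (by positivity) (Real.log_nonneg (by linarith))
    nlinarith
  obtain ⟨e, he, heq⟩ := hcu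
  have hlog : Tendsto (fun i => Real.log (u i)) l atTop :=
    Real.tendsto_log_atTop.comp (tendsto_natCast_atTop_atTop.comp hu)
  have he' : ∀ᶠ i in l, e i < (4 * K)⁻¹ := he.eventually_lt_const (by positivity)
  filter_upwards [he', heq, hlog.eventually_ge_atTop (max 1 (K * (16 * Real.log 16))),
    hu.eventually_ge_atTop 1] with i h1 h2 h3 h4
  have hu1 : (0 : ℝ) < u i := by exact_mod_cast h4
  have hc1 : (1 : ℝ) ≤ c i := by exact_mod_cast hc i
  have hL1 : 1 ≤ Real.log (u i) := (le_max_left _ _).trans h3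
  have hlogc : (c i : ℝ) ^ 2 * Real.log (c i) = e i * Real.log (u i) := by
    have := congrArg Real.log h2
    rw [Real.log_pow, Real.log_rpow hu1] at this
    push_cast at this
    exact this
  rcases le_total (c i) 4 with h | h
  · have hc4 : (c i : ℝ) ≤ 4 := by exact_mod_cast h
    have a1 : Real.log (4 * c i) ≤ Real.log 16 := Real.log_le_log (by linarith) (by linarith)
    have a2 : (c i : ℝ) ^ 2 ≤ 16 := by nlinarith
    calc K * ((c i : ℝ) ^ 2 * Real.log (4 * c i)) ≤ K * (16 * Real.log 16) := by
          gcongr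
          exact Real.log_nonneg (by linarith)
      _ ≤ _ := (le_max_right _ _).trans h3
  · have hc4 : (4 : ℝ) ≤ c i := by exact_mod_cast h
    have a1 : Real.log (4 * c i) ≤ 2 * Real.log (c i) := by
      rw [← Real.log_rpow (by linarith)]
      refine Real.log_le_log (by linarith) ?_
      rw [Real.rpow_two]
      nlinarith
    calc K * ((c i : ℝ) ^ 2 * Real.log (4 * c i)) ≤ K * ((c i : ℝ) ^ 2 * (2 * Real.log (c i))) := by
          gcongr
      _ = 2 * K * (e i * Real.log (u i)) := by rw [← hlogc]; ring
      _ ≤ 2 * K * ((4 * K)⁻¹ * Real.log (u i)) := by gcongr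
      _ ≤ Real.log (u i) := by
          field_simp
          linarith

/-- The length of the characters, so that `2 ^ b` is about `u ^ (1 / (2 * c))`. -/
noncomputable def charLength (u c : ℕ) : ℕ := ⌈Real.log u / (2 * c) / Real.log 2⌉₊

/-- The degree of independence. -/
noncomputable def indepDegree (u c : ℕ) : ℕ := ⌈(u : ℝ) ^ ((1 / 32 : ℝ) / (c : ℝ) ^ 2)⌉₊

/-! ### Size estimates for the chosen parameters. -/

theorem one_le_log_four_mul {c : ℕ} (hc : 1 ≤ c) : 1 ≤ Real.log (4 * c) := by
  have hc1 : (1 : ℝ) ≤ c := by exact_mod_cast hc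
  rw [Real.le_log_iff_exp_le (by linarith)]
  linarith [Real.exp_one_lt_d9]

theorem exp_le_two_pow_charLength (u c : ℕ) :
    Real.exp (Real.log u / (2 * c)) ≤ (2 : ℝ) ^ charLength u c := by
  have h2 : 0 < Real.log 2 := Real.log_pos (by norm_num)
  rw [← Real.exp_log (show (0 : ℝ) < 2 ^ charLength u c by positivity), Real.exp_le_exp,
    Real.log_pow, ← div_le_iff₀ h2]
  exact Nat.le_ceil _

theorem two_pow_charLength_le (u c : ℕ) :
    (2 : ℝ) ^ charLength u c ≤ 2 * Real.exp (Real.log u / (2 * c)) := by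
  have h2 : 0 < Real.log 2 := Real.log_pos (by norm_num)
  have hnn : 0 ≤ Real.log u / (2 * c) / Real.log 2 :=
    div_nonneg (div_nonneg (Real.log_natCast_nonneg u) (by positivity)) h2.le
  have h := (Nat.ceil_lt_add_one hnn).le
  have e : 2 * Real.exp (Real.log u / (2 * c)) =
      Real.exp (Real.log 2 + Real.log u / (2 * c)) := by
    rw [Real.exp_add, Real.exp_log two_pos]
  rw [e, ← Real.exp_log (show (0 : ℝ) < 2 ^ charLength u c by positivity), Real.exp_le_exp,
    Real.log_pow]
  calc (charLength u c : ℝ) * Real.log 2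
      ≤ (Real.log u / (2 * c) / Real.log 2 + 1) * Real.log 2 := by
        gcongr
        exact h
    _ = Real.log 2 + Real.log u / (2 * c) := by
        field_simp
        ring

theorem le_two_pow_charLength_mul {u c : ℕ} (hc : 1 ≤ c) (hu : 1 ≤ u) :
    u ≤ 2 ^ (charLength u c * (2 * c)) := by
  have hu0 : (0 : ℝ) < u := by exact_mod_cast hu
  have hc1 : (1 : ℝ) ≤ c := by exact_mod_cast hc
  have : (u : ℝ) ≤ 2 ^ (charLength u c * (2 * c)) := by
    calc (u : ℝ) = Real.exp (Real.log u / (2 * c)) ^ (2 * c) := by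
          rw [← Real.exp_nat_mul]
          push_cast
          rw [mul_div_cancel₀ _ (by positivity), Real.exp_log hu0]
      _ ≤ (2 ^ charLength u c) ^ (2 * c) := by
          gcongr
          exact exp_le_two_pow_charLength u c
      _ = _ := by rw [← pow_mul]
  exact_mod_cast this

theorem one_le_indepDegree {u c : ℕ} (hu : 1 ≤ u) : 1 ≤ indepDegree u c := by
  have hu0 : (0 : ℝ) < u := by exact_mod_cast hu
  exact Nat.one_le_ceil_iff.2 (by positivity)

/-- Since `k ≤ 2 u ^ (1/(32c²))`, the left side is at most `(4c) ^ (8c) * u ^ (1/(4c))`. The second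
factor is the square root of `u ^ (1/(2c))`, and the first is at most as large. This fixes the
constant `1/32`. -/
theorem indepDegree_pow_le {u c : ℕ} (hc : 1 ≤ c) (hu : 1 ≤ u)
    (hL : 130 * ((c : ℝ) ^ 2 * Real.log (4 * c)) ≤ Real.log u) :
    (2 * c * indepDegree u c) ^ (4 * (2 * c)) ≤ 2 ^ charLength u c := by
  have hu0 : (0 : ℝ) < u := by exact_mod_cast hu
  have hu1 : (1 : ℝ) ≤ u := by exact_mod_cast hu
  have hc1 : (1 : ℝ) ≤ c := by exact_mod_cast hc
  have hk : (indepDegree u c : ℝ) ≤ 2 * (u : ℝ) ^ ((1 / 32 : ℝ) / (c : ℝ) ^ 2) := by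
    have h1 : (1 : ℝ) ≤ (u : ℝ) ^ ((1 / 32 : ℝ) / (c : ℝ) ^ 2) :=
      Real.one_le_rpow hu1 (by positivity)
    have := (Nat.ceil_lt_add_one (zero_le_one.trans h1)).le
    calc (indepDegree u c : ℝ) ≤ (u : ℝ) ^ ((1 / 32 : ℝ) / (c : ℝ) ^ 2) + 1 := this
      _ ≤ _ := by linarith
  have key : ((2 * c * indepDegree u c : ℕ) : ℝ) ^ (4 * (2 * c)) ≤ 2 ^ charLength u c := by
    calc ((2 * c * indepDegree u c : ℕ) : ℝ) ^ (4 * (2 * c))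
        ≤ (4 * c * (u : ℝ) ^ ((1 / 32 : ℝ) / (c : ℝ) ^ 2)) ^ (4 * (2 * c)) := by
          push_cast
          gcongr ?_ ^ _
          calc 2 * (c : ℝ) * indepDegree u c
              ≤ 2 * c * (2 * (u : ℝ) ^ ((1 / 32 : ℝ) / (c : ℝ) ^ 2)) := by gcongr
            _ = _ := by ring
      _ = Real.exp (8 * c * Real.log (4 * c) + Real.log u / (2 * c) / 2) := by
          rw [Real.rpow_def_of_pos hu0, ← Real.exp_log (show (0 : ℝ) < 4 * c by positivity),
            ← Real.exp_add, ← Real.exp_nat_mul, Real.exp_log (show (0 : ℝ) < 4 * c by positivity)]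
          congr 1
          push_cast
          field_simp
          ring
      _ ≤ Real.exp (Real.log u / (2 * c)) := by
          rw [Real.exp_le_exp]
          have : 8 * c * Real.log (4 * c) ≤ Real.log u / (2 * c) / 2 := by
            rw [div_div, le_div_iff₀ (by positivity)]
            nlinarith [one_le_log_four_mul hc, sq_nonneg (c : ℝ),
              mul_nonneg (sq_nonneg (c : ℝ)) (zero_le_one.trans (one_le_log_four_mul hc))]
          linarith
      _ ≤ _ := exp_le_two_pow_charLength u c
  exact_mod_cast key

/-- The left side is at most `(4c) ^ (64c + 1)`, and `2c (64c + 1) ≤ 130 c²`; this is where `130`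
comes from. -/
theorem mul_two_pow_le_two_pow_charLength {u c : ℕ} (hc : 1 ≤ c)
    (hL : 130 * ((c : ℝ) ^ 2 * Real.log (4 * c)) ≤ Real.log u) :
    2 * c * 2 ^ (64 * c) ≤ 2 ^ charLength u c := by
  have hc1 : (1 : ℝ) ≤ c := by exact_mod_cast hc
  have h1 := one_le_log_four_mul hc
  have key : (2 * c * 2 ^ (64 * c) : ℝ) ≤ 2 ^ charLength u c := by
    calc (2 * c * 2 ^ (64 * c) : ℝ) ≤ 4 * c * (4 * c) ^ (64 * c) := by
          gcongr <;> linarith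
      _ = Real.exp (Real.log (4 * c) + 64 * c * Real.log (4 * c)) := by
          rw [Real.exp_add, Real.exp_log (by positivity)]
          congr 1
          rw [← Real.exp_log (show (0 : ℝ) < 4 * c by positivity), ← Real.exp_nat_mul,
            Real.exp_log (show (0 : ℝ) < 4 * c by positivity)]
          push_cast
          ring_nf
      _ ≤ Real.exp (Real.log u / (2 * c)) := by
          rw [Real.exp_le_exp, le_div_iff₀ (by positivity)]
          have : (c : ℝ) * Real.log (4 * c) ≤ c ^ 2 * Real.log (4 * c) := by
            gcongr
            nlinarith
          nlinarith
      _ ≤ _ := exp_le_two_pow_charLength u c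
  exact_mod_cast key

/-- Makes `c` packed characters fit in any word that holds a key: `2 ^ (bc) ≤ 2 ^ c * √u`. -/
theorem two_pow_charLength_mul_le {u c : ℕ} (hc : 1 ≤ c) (hu : 1 ≤ u)
    (hL : 130 * ((c : ℝ) ^ 2 * Real.log (4 * c)) ≤ Real.log u) :
    2 ^ (charLength u c * c) ≤ u := by
  have hu0 : (0 : ℝ) < u := by exact_mod_cast hu
  have hc1 : (1 : ℝ) ≤ c := by exact_mod_cast hc
  have h1 := one_le_log_four_mul hc
  have key : (2 : ℝ) ^ (charLength u c * c) ≤ u := by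
    calc (2 : ℝ) ^ (charLength u c * c) = (2 ^ charLength u c) ^ c := by rw [pow_mul]
      _ ≤ (4 * c * Real.exp (Real.log u / (2 * c))) ^ c := by
          gcongr
          refine (two_pow_charLength_le u c).trans ?_
          gcongr
          linarith
      _ = Real.exp (c * Real.log (4 * c) + Real.log u / 2) := by
          rw [← Real.exp_log (show (0 : ℝ) < 4 * c by positivity), ← Real.exp_add,
            ← Real.exp_nat_mul, Real.exp_log (show (0 : ℝ) < 4 * c by positivity)]
          congr 1
          field_simp
      _ ≤ Real.exp (Real.log u) := by
          rw [Real.exp_le_exp]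
          have : (c : ℝ) * Real.log (4 * c) ≤ c ^ 2 * Real.log (4 * c) := by
            gcongr
            nlinarith
          nlinarith
      _ = u := Real.exp_log hu0
  exact_mod_cast key

/-- The gap between `u ^ (1/(2c))` and `u ^ (1/c)` thus beats `c` and any constant, which yields
both little-o claims. -/
theorem eventually_mul_le_exp {ι : Type} {l : Filter ι} {u c : ι → ℕ} (hu : Tendsto u l atTop)
    (hc : ∀ i, 1 ≤ c i)
    (hcu : IsPowLittleOOne l (fun i => (c i : ℝ) ^ (c i ^ 2)) (fun i => (u i : ℝ))) (K : ℝ) :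
    ∀ᶠ i in l, K * c i ≤ Real.exp (Real.log (u i) / (2 * c i)) := by
  filter_upwards [eventually_mul_log_le hu hc hcu (2 * (|Real.log K| + 1))] with i hi
  have hc1 : (1 : ℝ) ≤ c i := by exact_mod_cast hc i
  have h1 := one_le_log_four_mul (hc i)
  rcases le_or_gt K 0 with hK | hK
  · exact (mul_nonpos_of_nonpos_of_nonneg hK (by positivity)).trans (Real.exp_pos _).le
  have h2 := le_abs_self (Real.log K)
  have h3 := abs_nonneg (Real.log K)
  calc K * c i ≤ K * (4 * c i) := by gcongr; linarith
    _ = Real.exp (Real.log K + Real.log (4 * c i)) := by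
        rw [Real.exp_add, Real.exp_log hK, Real.exp_log (by positivity)]
    _ ≤ Real.exp ((|Real.log K| + 1) * (c i * Real.log (4 * c i))) := by
        rw [Real.exp_le_exp]
        have : Real.log (4 * c i) ≤ c i * Real.log (4 * c i) :=
          le_mul_of_one_le_left (by linarith) hc1
        nlinarith
    _ ≤ _ := by
        rw [Real.exp_le_exp, le_div_iff₀ (by positivity)]
        linarith

theorem rpow_one_div_eq_exp_sq {u c : ℕ} (hu : 1 ≤ u) :
    (u : ℝ) ^ (1 / (c : ℝ)) = Real.exp (Real.log u / (2 * c)) ^ 2 := by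
  have hu0 : (0 : ℝ) < u := by exact_mod_cast hu
  rw [Real.rpow_def_of_pos hu0, ← Real.exp_nat_mul]
  congr 1
  push_cast
  ring

theorem memSize_le {u c : ℕ} (hc : 1 ≤ c) :
    (memSize (charLength u c) c 64 : ℝ) ≤ 400 * c * Real.exp (Real.log u / (2 * c)) := by
  have hc1 : (1 : ℝ) ≤ c := by exact_mod_cast hc
  have h1 : (1 : ℝ) ≤ Real.exp (Real.log u / (2 * c)) :=
    Real.one_le_exp (div_nonneg (Real.log_natCast_nonneg u) (by positivity))
  have h2 := two_pow_charLength_le u c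
  rw [memSize]
  push_cast
  nlinarith [mul_le_mul_of_nonneg_left h2 (zero_le_one.trans hc1)]

theorem isLittleO_memSize {ι : Type} {l : Filter ι} {u c : ι → ℕ} (hu : Tendsto u l atTop)
    (hc : ∀ i, 1 ≤ c i)
    (hcu : IsPowLittleOOne l (fun i => (c i : ℝ) ^ (c i ^ 2)) (fun i => (u i : ℝ))) :
    (fun i => (memSize (charLength (u i) (c i)) (c i) 64 : ℝ)) =o[l]
      (fun i => (u i : ℝ) ^ (1 / (c i : ℝ))) := by
  rw [isLittleO_iff]
  intro ε hε
  filter_upwards [eventually_mul_le_exp hu hc hcu (400 / ε), hu.eventually_ge_atTop 1]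
    with i hi h1
  rw [rpow_one_div_eq_exp_sq h1, Real.norm_of_nonneg (Nat.cast_nonneg _),
    Real.norm_of_nonneg (by positivity)]
  refine (memSize_le (hc i)).trans ?_
  rw [div_mul_eq_mul_div, div_le_iff₀ hε] at hi
  nlinarith [mul_le_mul_of_nonneg_right hi (Real.exp_pos (Real.log (u i) / (2 * c i))).le]

theorem isLittleO_unifProb_not_isUniversal {ι : Type} {l : Filter ι} {u c : ι → ℕ}
    (hu : Tendsto u l atTop) (hc : ∀ i, 1 ≤ c i)
    (hcu : IsPowLittleOOne l (fun i => (c i : ℝ) ^ (c i ^ 2)) (fun i => (u i : ℝ))) :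
    (fun i => unifProb {h : FirstTables (charLength (u i) (c i)) (2 * c i) (64 * c i) |
        ¬ IsUniversal (u i) (indepDegree (u i) (c i)) h}) =o[l]
      (fun i => 1 / (u i : ℝ) ^ (1 / (c i : ℝ))) := by
  rw [isLittleO_iff]
  intro ε hε
  filter_upwards [eventually_mul_le_exp hu hc hcu (1 / ε), hu.eventually_ge_atTop 1,
    eventually_mul_log_le hu hc hcu 130] with i hi h1 hL
  have hc1 : (1 : ℝ) ≤ c i := by exact_mod_cast hc i
  have hbound := unifProb_not_isUniversal_le (d := 64 * c i) (by have := hc i; omega)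
    (le_two_pow_charLength_mul (hc i) h1) (one_le_indepDegree (c := c i) h1) (by ring)
    (indepDegree_pow_le (hc i) h1 hL) (mul_two_pow_le_two_pow_charLength (hc i) hL)
  have hnn : 0 ≤ unifProb {h : FirstTables (charLength (u i) (c i)) (2 * c i) (64 * c i) |
      ¬ IsUniversal (u i) (indepDegree (u i) (c i)) h} := MeasureTheory.measureReal_nonneg
  rw [rpow_one_div_eq_exp_sq h1, Real.norm_of_nonneg hnn, Real.norm_of_nonneg (by positivity)]
  refine hbound.trans ?_
  have hB := exp_le_two_pow_charLength (u i) (c i)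
  set E := Real.exp (Real.log (u i) / (2 * c i)) with hE
  have hE1 : 1 ≤ E :=
    Real.one_le_exp (div_nonneg (Real.log_natCast_nonneg _) (by positivity))
  have hE0 : 0 < E := by positivity
  have hεE : 1 ≤ ε * E := by
    rw [div_mul_eq_mul_div, div_le_iff₀ hε, one_mul] at hi
    linarith
  -- The target is `ε * E ^ (-2)`; one spare factor `E` already suffices, since `ε * E ≥ 1`
  -- eventually.
  calc (((2 : ℝ) ^ charLength (u i) (c i)) ^ 5)⁻¹ ≤ (E ^ 5)⁻¹ := by gcongr
    _ ≤ (E ^ 3)⁻¹ := by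
        gcongr
        norm_num
    _ ≤ (ε * E) * (E ^ 3)⁻¹ := le_mul_of_one_le_left (by positivity) hεE
    _ = ε * (1 / E ^ 2) := by field_simp

/-- The layout needs `bc ≤ w` and `S < 2 ^ w`; both follow from `u ≤ 2 ^ w`, the second because `S ≤
u ^ (1/c) / 2 < u`. -/
theorem eventually_evaluates {ι : Type} {l : Filter ι} {u c : ι → ℕ}
    (hu : Tendsto u l atTop) (hc : ∀ i, 1 ≤ c i)
    (hcu : IsPowLittleOOne l (fun i => (c i : ℝ) ^ (c i ^ 2)) (fun i => (u i : ℝ))) :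
    ∀ᶠ i in l, ∀ w ρ : ℕ, u i ≤ 2 ^ w →
      ∀ (h : FirstTables (charLength (u i) (c i)) (2 * c i) (64 * c i))
        (r : SecondTables (charLength (u i) (c i)) (64 * c i) ρ),
        Evaluates evalProgram w (memSize (charLength (u i) (c i)) (c i) 64) (1807 * c i)
          (doubleTab (u i) h r) := by
  filter_upwards [(isLittleO_memSize hu hc hcu).bound (show (0 : ℝ) < 1 / 2 by norm_num),
    hu.eventually_ge_atTop 1, eventually_mul_log_le hu hc hcu 130] with i hS h1 hL w ρ hw h r
  have hu1 : (1 : ℝ) ≤ u i := by exact_mod_cast h1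
  have hc1 : (1 : ℝ) ≤ c i := by exact_mod_cast hc i
  refine evaluates_doubleTab w h r (hc i) (by norm_num) ?_ hw (lt_of_lt_of_le ?_ hw)
  · exact (Nat.pow_le_pow_iff_right (by norm_num)).1
      ((two_pow_charLength_mul_le (hc i) h1 hL).trans hw)
  · rw [Real.norm_of_nonneg (Nat.cast_nonneg _), Real.norm_of_nonneg (by positivity)] at hS
    have h2 : (u i : ℝ) ^ (1 / (c i : ℝ)) ≤ u i := by
      calc (u i : ℝ) ^ (1 / (c i : ℝ)) ≤ (u i : ℝ) ^ (1 : ℝ) :=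
            Real.rpow_le_rpow_of_exponent_le hu1 (by
              rw [div_le_one (by positivity)]
              exact hc1)
        _ = u i := Real.rpow_one _
    have : (memSize (charLength (u i) (c i)) (c i) 64 : ℝ) < u i := by linarith
    exact_mod_cast this

end DoubleTab

theorem corollary3 :
    ∃ (P : DoubleTab.Cmd) (A : ℕ) (δ : ℝ), 0 < δ ∧
      ∀ (ι : Type) (l : Filter ι) (u c : ι → ℕ),
        Tendsto u l atTop → (∀ i, 1 ≤ c i) →
        DoubleTab.IsPowLittleOOne l (fun i => (c i : ℝ) ^ (c i ^ 2)) (fun i => (u i : ℝ)) →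
        -- `n` input characters and `d` intermediate characters, all of `b` bits;
        -- independence `k`; `S` words of space
        ∃ n d b k S : ι → ℕ,
          (∀ᶠ i in l, u i ≤ 2 ^ (b i * n i)) ∧
          (∀ᶠ i in l, (u i : ℝ) ^ (δ / (c i : ℝ) ^ 2) ≤ (k i : ℝ)) ∧
          (fun i => DoubleTab.unifProb
              {h : DoubleTab.FirstTables (b i) (n i) (d i) |
                ¬ DoubleTab.IsUniversal (u i) (k i) h})
            =o[l] (fun i => 1 / (u i : ℝ) ^ (1 / (c i : ℝ))) ∧
          (fun i => (S i : ℝ)) =o[l] (fun i => (u i : ℝ) ^ (1 / (c i : ℝ))) ∧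
          (∀ᶠ i in l, ∀ w ρ : ℕ, u i ≤ 2 ^ w → ρ ≤ w →
            ∀ (h : DoubleTab.FirstTables (b i) (n i) (d i))
              (r : DoubleTab.SecondTables (b i) (d i) ρ),
              DoubleTab.Evaluates P w (S i) (A * c i) (DoubleTab.doubleTab (u i) h r)) := by
  -- `1807 = 28 * 64 + 15`, the step count for 64 groups.
  refine ⟨DoubleTab.evalProgram, 1807, 1 / 32, by norm_num, fun ι l u c hu hc hcu => ?_⟩
  refine ⟨fun i => 2 * c i, fun i => 64 * c i, fun i => DoubleTab.charLength (u i) (c i),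
    fun i => DoubleTab.indepDegree (u i) (c i),
    fun i => DoubleTab.memSize (DoubleTab.charLength (u i) (c i)) (c i) 64, ?_, ?_,
    DoubleTab.isLittleO_unifProb_not_isUniversal hu hc hcu,
    DoubleTab.isLittleO_memSize hu hc hcu, ?_⟩
  · filter_upwards [hu.eventually_ge_atTop 1] with i hi
    exact DoubleTab.le_two_pow_charLength_mul (hc i) hi
  · exact Eventually.of_forall fun i => Nat.le_ceil _
  · filter_upwards [DoubleTab.eventually_evaluates hu hc hcu] with i hi w ρ hw _ h r
    exact hi w ρ hw h r
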